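/- Let $\mathbb P^{1|1}$ be the complex projective superspace of dimension $1|1$ (in the holomorphic category): it is glued from two copies of $\mathbb C^{1|1}$ with coordinates $(z_0|\theta_0)$ over $U_0=\mathbb P^1\setminus\{\infty\}$ and $(z_1|\theta_1)$ over $U_1=\mathbb P^1\setminus\{0\}$ by $z_0=1/z_1$, $\theta_0=\theta_1/z_1$. Let $\mathcal T$ and $\mathcal T^*$ be its tangent and cotangent sheaves, $\Pi$ the reversal of parity, $Sym^k$ the supersymmetric power, and $\mathcal Ber=\mathcal Ber(\Pi\mathcal T^*)^*$ the Berezinian sheaf, whose local generator is taken to be even. For $k\in\mathbb Z$ the Large Hilbert Space of $\mathbb P^{1|1}$ in degree $k$ is the sheaf $$\mathcal{LHS}^k=\begin{cases} Sym^k\Pi\mathcal T^* & k>0,\\ (\mathcal O_{\mathbb P^{1|1}}\oplus\Pi\mathcal Ber)\oplus\mathcal Ber & k=0,\\ (\Pi\mathcal Ber\otimes Sym^{|k|}\Pi\mathcal T)\oplus(\mathcal Ber\otimes Sym^{|k|}\Pi\mathcal T) & k<0.\end{cases}$$ Let $H^0,H^1$ denote Čech cohomology with respect to the standard cover $\{U_0,U_1\}$,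 as complex super vector spaces, and let isomorphisms be parity preserving. (1) For every $k\ge 1$ there is an isomorphism of sheaves of $\mathbb Z/2$-graded $\mathcal O_{\mathbb P^1}$-modules $$Sym^k\Pi\mathcal T^*\cong\mathcal O_{\mathbb P^1}(-k-1)^{\oplus 2}\oplus\Pi\,\mathcal O_{\mathbb P^1}(-k-1)^{\oplus 2},$$ and $H^0(Sym^k\Pi\mathcal T^*)=0$, $H^1(Sym^k\Pi\mathcal T^*)\cong\mathbb C^{2k|2k}$. Moreover $H^0(\mathcal Ber\otimes Sym^k\Pi\mathcal T)\cong\mathbb C^{2k|2k}$ and $H^1(\mathcal Ber\otimes Sym^k\Pi\mathcal T)=0$, and the same holds with $\Pi\mathcal Ber$ in place of $\mathcal Ber$. (2) $H^0(\mathcal O_{\mathbb P^{1|1}})\cong\mathbb C^{1|0}$, $H^1(\mathcal O_{\mathbb P^{1|1}})=0$, $H^0(\mathcal Ber)=0$, $H^1(\mathcal Ber)\cong\mathbb C^{0|1}$, $H^0(\Pi\mathcal Ber)=0$, $H^1(\Pi\mathcal Ber)\cong\mathbb C^{1|0}$. (3) Consequently, in every degree $k\in\mathbb Z$, $$H^0(\mathcal{LHS}^k)\cong\begin{cases}0&k>0,\\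 \mathbb C^{1|0}&k=0,\\ \mathbb C^{2|k|\,|\,2|k|}\oplus\mathbb C^{2|k|\,|\,2|k|}&k<0,\end{cases}\qquad H^1(\mathcal{LHS}^k)\cong\begin{cases}\mathbb C^{2k|2k}&k>0,\\ \mathbb C^{1|1}&k=0,\\ 0&k<0.\end{cases}$$ -/

import Mathlib

open TopologicalSpace

/-! ## The Riemann sphere and its holomorphic functions -/

/-- The complex projective line, as the Riemann sphere `ℂ ∪ {∞}`. -/
abbrev P1 : Type := OnePoint ℂ

/-- The inverse of the affine chart around `∞`: `w ↦ 1/w`, with `0 ↦ ∞`. The inverse of the other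
affine chart is the inclusion `ℂ → P1`. -/
noncomputable def chartInfty (w : ℂ) : P1 := if w = 0 then OnePoint.infty else ((w⁻¹ : ℂ) : P1)

theorem chartInfty_of_ne {w : ℂ} (hw : w ≠ 0) : chartInfty w = ((w⁻¹ : ℂ) : P1) := by
  simp [chartInfty, hw]

theorem continuous_chartInfty : Continuous chartInfty := by
  rw [continuous_iff_continuousAt]
  intro w
  by_cases hw : w = 0
  · subst hw
    have h0 : chartInfty 0 = OnePoint.infty := by simp [chartInfty]
    rw [ContinuousAt, h0]
    rw [← nhdsNE_sup_pure (0 : ℂ), Filter.tendsto_sup]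
    refine ⟨?_, ?_⟩
    · have h1 : Filter.Tendsto (fun w : ℂ => ((w⁻¹ : ℂ) : P1)) (nhdsWithin 0 {0}ᶜ)
          (nhds OnePoint.infty) := by
        refine (OnePoint.tendsto_coe_infty (X := ℂ)).comp ?_
        rw [Filter.coclosedCompact_eq_cocompact, ← Metric.cobounded_eq_cocompact]
        exact Filter.tendsto_inv₀_nhdsNE_zero
      refine h1.congr' ?_
      filter_upwards [self_mem_nhdsWithin] with x hx
      exact (chartInfty_of_ne hx).symm
    · rw [← h0]
      exact tendsto_pure_nhds chartInfty 0
  · have h1 : ContinuousAt (fun w : ℂ => ((w⁻¹ : ℂ) : P1)) w :=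
      OnePoint.continuous_coe.continuousAt.comp (continuousAt_inv₀ hw)
    refine h1.congr ?_
    filter_upwards [isOpen_ne.mem_nhds hw] with x hx
    exact (chartInfty_of_ne hx).symm

/-- The standard open set `U₀ = P1 ∖ {∞}`. -/
def U0 : Opens P1 := ⟨{OnePoint.infty}ᶜ, isOpen_compl_singleton⟩

/-- The standard open set `U₁ = P1 ∖ {0}`. -/
def U1 : Opens P1 := ⟨{((0 : ℂ) : P1)}ᶜ, isOpen_compl_singleton⟩

/-- An open subset of the sphere, seen in the coordinate `z` of `U₀`. -/
def chart0 (V : Opens P1) : Opens ℂ := ⟨{z | (z : P1) ∈ V}, V.isOpen.preimage OnePoint.continuous_coe⟩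

/-- An open subset of the sphere, seen in the coordinate `w = 1/z` of `U₁`. -/
def chart1 (V : Opens P1) : Opens ℂ := ⟨{w | chartInfty w ∈ V}, V.isOpen.preimage continuous_chartInfty⟩

/-- The punctured plane: `U₀ ∩ U₁` in the coordinate `w`. -/
def Cstar : Opens ℂ := ⟨{0}ᶜ, isOpen_compl_singleton⟩

/-- `V ∩ U₀ ∩ U₁` in the coordinate `w`. -/
noncomputable def overlap (V : Opens P1) : Opens ℂ := chart1 V ⊓ Cstar

/-- The subalgebra of holomorphic functions among the functions on an open subset of `ℂ`. -/
noncomputable def holSubalgebra (W : Opens ℂ) : Subalgebra ℂ (W → ℂ) where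
  carrier := {f | ∃ g : ℂ → ℂ, DifferentiableOn ℂ g W ∧ ∀ z : W, g z = f z}
  mul_mem' := by
    rintro f f' ⟨g, hg, h⟩ ⟨g', hg', h'⟩
    exact ⟨g * g', hg.mul hg', fun z => by simp [h, h']⟩
  add_mem' := by
    rintro f f' ⟨g, hg, h⟩ ⟨g', hg', h'⟩
    exact ⟨g + g', hg.add hg', fun z => by simp [h, h']⟩
  algebraMap_mem' := fun c => ⟨fun _ => c, differentiableOn_const c, fun _ => rfl⟩

/-- The algebra of holomorphic functions on an open subset of `ℂ`. -/
def Hol (W : Opens ℂ) : Type := holSubalgebra W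

noncomputable instance instCommRingHol (W : Opens ℂ) : CommRing (Hol W) :=
  inferInstanceAs (CommRing (holSubalgebra W))

noncomputable instance instAlgebraHol (W : Opens ℂ) : Algebra ℂ (Hol W) :=
  inferInstanceAs (Algebra ℂ (holSubalgebra W))

/-- Pull-back of holomorphic functions along a holomorphic map `φ : W' → W`. -/
noncomputable def Hol.pull {W W' : Opens ℂ} (φ : ℂ → ℂ) (hd : DifferentiableOn ℂ φ W')
    (hm : Set.MapsTo φ W' W) : Hol W →ₐ[ℂ] Hol W' where
  toFun f := ⟨fun w => f.1 ⟨φ w, hm w.2⟩, by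
    obtain ⟨g, hg, h⟩ := f.2
    exact ⟨g ∘ φ, hg.comp hd hm, fun w => h ⟨φ w, hm w.2⟩⟩⟩
  map_one' := rfl
  map_mul' _ _ := rfl
  map_zero' := rfl
  map_add' _ _ := rfl
  commutes' _ := rfl

/-- The complex derivative of a holomorphic function. -/
noncomputable def Hol.deriv {W : Opens ℂ} (f : Hol W) : Hol W :=
  ⟨fun z => _root_.deriv (Function.extend Subtype.val f.1 0) z, by
    obtain ⟨g, hg, h⟩ := f.2
    refine ⟨_root_.deriv g, hg.deriv W.isOpen, fun z => ?_⟩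
    refine Filter.EventuallyEq.deriv_eq ?_
    filter_upwards [W.isOpen.mem_nhds z.2] with x hx
    rw [h ⟨x, hx⟩]
    exact (Subtype.val_injective.extend_apply f.1 0 ⟨x, hx⟩).symm⟩

/-- The function `w ↦ 1/w` on the punctured plane. -/
noncomputable def invFn : Hol Cstar :=
  ⟨fun w => (w : ℂ)⁻¹, fun w => w⁻¹,
    fun w hw => (differentiableAt_inv (show w ≠ 0 from hw)).differentiableWithinAt, fun _ => rfl⟩

/-- The function `w ↦ w` on the punctured plane. -/
def idFn : Hol Cstar := ⟨fun w => (w : ℂ), fun w => w, differentiableOn_id, fun _ => rfl⟩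

/-- The coordinate `w` as a unit of the algebra of functions on the punctured plane. -/
noncomputable def wUnit : (Hol Cstar)ˣ where
  val := idFn
  inv := invFn
  val_inv := Subtype.ext (funext fun w => mul_inv_cancel₀ (show (w : ℂ) ≠ 0 from w.2))
  inv_val := Subtype.ext (funext fun w => inv_mul_cancel₀ (show (w : ℂ) ≠ 0 from w.2))

/-- Restriction of holomorphic functions. -/
noncomputable def Hol.res {W W' : Opens ℂ} (h : W' ≤ W) : Hol W →ₐ[ℂ] Hol W' :=
  Hol.pull id differentiableOn_id h

/-- The change of coordinate `z = 1/w` on functions, from `V ∩ U₀` to `V ∩ U₀ ∩ U₁`. -/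
noncomputable def Hol.toOverlap (V : Opens P1) : Hol (chart0 V) →ₐ[ℂ] Hol (overlap V) :=
  Hol.pull (fun w => w⁻¹)
    (fun w hw => (differentiableAt_inv (show w ≠ 0 from hw.2)).differentiableWithinAt)
    (fun w hw => by
      have h1 : chartInfty w ∈ V := hw.1
      rwa [chartInfty_of_ne (show w ≠ 0 from hw.2)] at h1)

theorem overlap_le_chart1 (V : Opens P1) : overlap V ≤ chart1 V := inf_le_left

theorem overlap_le_Cstar (V : Opens P1) : overlap V ≤ Cstar := inf_le_right

theorem chart0_mono {U V : Opens P1} (h : U ≤ V) : chart0 U ≤ chart0 V := fun _ hz => h hz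

theorem chart1_mono {U V : Opens P1} (h : U ≤ V) : chart1 U ≤ chart1 V := fun _ hz => h hz

theorem overlap_mono {U V : Opens P1} (h : U ≤ V) : overlap U ≤ overlap V :=
  inf_le_inf_right _ (chart1_mono h)

/-- Pairs of holomorphic functions in the two affine coordinates that agree on the overlap. -/
noncomputable def op1Subalgebra (V : Opens P1) : Subalgebra ℂ (Hol (chart0 V) × Hol (chart1 V)) :=
  AlgHom.equalizer ((Hol.toOverlap V).comp (AlgHom.fst ℂ _ _))
    ((Hol.res (overlap_le_chart1 V)).comp (AlgHom.snd ℂ _ _))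

/-- The structure sheaf of the projective line: a function on `V` is a pair of holomorphic
functions in the two affine coordinates that agree on the overlap. -/
def OP1 (V : Opens P1) : Type := op1Subalgebra V

noncomputable instance instCommRingOP1 (V : Opens P1) : CommRing (OP1 V) :=
  inferInstanceAs (CommRing (op1Subalgebra V))

noncomputable instance instAlgebraOP1 (V : Opens P1) : Algebra ℂ (OP1 V) :=
  inferInstanceAs (Algebra ℂ (op1Subalgebra V))

/-- A function on `V` in the coordinate of `U₀`. -/
noncomputable def OP1.in0 (V : Opens P1) : OP1 V →ₐ[ℂ] Hol (chart0 V) :=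
  (AlgHom.fst ℂ _ _).comp (op1Subalgebra V).val

/-- A function on `V` in the coordinate of `U₁`. -/
noncomputable def OP1.in1 (V : Opens P1) : OP1 V →ₐ[ℂ] Hol (chart1 V) :=
  (AlgHom.snd ℂ _ _).comp (op1Subalgebra V).val

theorem OP1.glue {V : Opens P1} (f : OP1 V) :
    Hol.toOverlap V (OP1.in0 V f) = Hol.res (overlap_le_chart1 V) (OP1.in1 V f) := f.2

/-- Restriction of functions on the projective line. -/
noncomputable def OP1.res {U V : Opens P1} (h : U ≤ V) (f : OP1 V) : OP1 U :=
  ⟨(Hol.res (chart0_mono h) (OP1.in0 V f), Hol.res (chart1_mono h) (OP1.in1 V f)),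
    congrArg (Hol.res (overlap_mono h)) (OP1.glue f)⟩

/-! ## Sheaves of `ℤ/2`-graded modules over the structure sheaf of the projective line -/

/-- A presheaf of `ℤ/2`-graded modules over the structure sheaf of the projective line;
`obj V p` are the sections over `V` of parity `p`. -/
structure SuperMod where
  obj : Opens P1 → ZMod 2 → Type
  [grp : ∀ V p, AddCommGroup (obj V p)]
  [modC : ∀ V p, Module ℂ (obj V p)]
  [mod : ∀ V p, Module (OP1 V) (obj V p)]
  [tower : ∀ V p, IsScalarTower ℂ (OP1 V) (obj V p)]
  res : ∀ {U V : Opens P1}, U ≤ V → ∀ p, obj V p →ₗ[ℂ] obj U p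
  res_smul : ∀ {U V : Opens P1} (h : U ≤ V) (p) (f : OP1 V) (s : obj V p),
    res h p (f • s) = OP1.res h f • res h p s
  res_refl : ∀ (V : Opens P1) (p) (s : obj V p), res (le_refl V) p s = s
  res_trans : ∀ {T U V : Opens P1} (h : T ≤ U) (h' : U ≤ V) (p) (s : obj V p),
    res h p (res h' p s) = res (h.trans h') p s

attribute [instance] SuperMod.grp SuperMod.modC SuperMod.mod SuperMod.tower

namespace SuperMod

/-- Parity-preserving isomorphisms of graded modules over the structure sheaf of the projective
line. -/
structure Iso (F G : SuperMod) where
  equiv : ∀ V p, F.obj V p ≃ₗ[OP1 V] G.obj V p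
  naturality : ∀ {U V : Opens P1} (h : U ≤ V) (p) (s : F.obj V p),
    equiv U p (F.res h p s) = G.res h p (equiv V p s)

/-- Direct sum. -/
noncomputable def sum (F G : SuperMod) : SuperMod where
  obj V p := F.obj V p × G.obj V p
  res h p := (F.res h p).prodMap (G.res h p)
  res_smul h p f s := Prod.ext (F.res_smul h p f s.1) (G.res_smul h p f s.2)
  res_refl V p s := Prod.ext (F.res_refl V p s.1) (G.res_refl V p s.2)
  res_trans h h' p s := Prod.ext (F.res_trans h h' p s.1) (G.res_trans h h' p s.2)

/-- Reversal of parity. -/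
noncomputable def Pi (F : SuperMod) : SuperMod where
  obj V p := F.obj V (p + 1)
  res h p := F.res h (p + 1)
  res_smul h p f s := F.res_smul h (p + 1) f s
  res_refl V p s := F.res_refl V (p + 1) s
  res_trans h h' p s := F.res_trans h h' (p + 1) s

/-- The Čech differential `(s₀, s₁) ↦ s₁ - s₀` of the standard cover `{U₀, U₁}`. -/
noncomputable def cechD (F : SuperMod) (p : ZMod 2) :
    (F.obj U0 p × F.obj U1 p) →ₗ[ℂ] F.obj (U0 ⊓ U1) p :=
  (F.res inf_le_right p).comp (LinearMap.snd ℂ _ _) -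
    (F.res inf_le_left p).comp (LinearMap.fst ℂ _ _)

/-- The part of parity `p` of the Čech cohomology in degree 0. -/
abbrev H0 (F : SuperMod) (p : ZMod 2) : Type := LinearMap.ker (F.cechD p)

/-- The part of parity `p` of the Čech cohomology in degree 1. -/
abbrev H1 (F : SuperMod) (p : ZMod 2) : Type :=
  F.obj (U0 ⊓ U1) p ⧸ LinearMap.range (F.cechD p)

end SuperMod

/-- The super vector space with even part `H 0` and odd part `H 1` is isomorphic to `ℂ^{m|n}`. -/
def IsSuperC (H : ZMod 2 → Type) [∀ p, AddCommGroup (H p)] [∀ p, Module ℂ (H p)] (m n : ℕ) : Prop :=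
  Nonempty (H 0 ≃ₗ[ℂ] (Fin m → ℂ)) ∧ Nonempty (H 1 ≃ₗ[ℂ] (Fin n → ℂ))

noncomputable instance instModuleOP1Hol0 (V : Opens P1) : Module (OP1 V) (Hol (chart0 V)) :=
  Module.compHom _ (OP1.in0 V).toRingHom

noncomputable instance instModuleOP1Hol1 (V : Opens P1) : Module (OP1 V) (Hol (chart1 V)) :=
  Module.compHom _ (OP1.in1 V).toRingHom

theorem OP1.smul_def0 {V : Opens P1} (f : OP1 V) (a : Hol (chart0 V)) : f • a = OP1.in0 V f * a := rfl

theorem OP1.smul_def1 {V : Opens P1} (f : OP1 V) (a : Hol (chart1 V)) : f • a = OP1.in1 V f * a := rfl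

instance instTowerOP1Hol0 (V : Opens P1) : IsScalarTower ℂ (OP1 V) (Hol (chart0 V)) :=
  ⟨fun c f a => by rw [OP1.smul_def0, OP1.smul_def0, map_smul, smul_mul_assoc]⟩

instance instTowerOP1Hol1 (V : Opens P1) : IsScalarTower ℂ (OP1 V) (Hol (chart1 V)) :=
  ⟨fun c f a => by rw [OP1.smul_def1, OP1.smul_def1, map_smul, smul_mul_assoc]⟩

/-- The sections of parity `p` over `V` of the line bundle `𝒪(n)` on the projective line, placed in
even parity: the frames over `U₀` and `U₁` are related by `e₀ = wⁿ e₁`. -/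
noncomputable def lineSections (n : ℤ) (V : Opens P1) (p : ZMod 2) :
    Submodule (OP1 V) (Hol (chart0 V) × Hol (chart1 V)) where
  carrier := {s | Hol.res (overlap_le_chart1 V) s.2 =
    Hol.toOverlap V s.1 * Hol.res (overlap_le_Cstar V) ((wUnit ^ n : (Hol Cstar)ˣ) : Hol Cstar) ∧
    (p = 1 → s = 0)}
  add_mem' := by
    rintro s t ⟨hs, hs'⟩ ⟨ht, ht'⟩
    refine ⟨?_, fun h => by rw [hs' h, ht' h, add_zero]⟩
    rw [Prod.fst_add, Prod.snd_add, map_add, map_add, hs, ht, add_mul]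
  zero_mem' := ⟨by simp, fun _ => rfl⟩
  smul_mem' := by
    rintro f s ⟨hs, hs'⟩
    refine ⟨?_, fun h => by rw [hs' h, smul_zero]⟩
    rw [Prod.smul_fst, Prod.smul_snd, OP1.smul_def0, OP1.smul_def1, map_mul, map_mul, hs,
      OP1.glue, mul_assoc]

/-- The line bundle `𝒪(n)` on the projective line, placed in even parity. -/
noncomputable def lineBundle (n : ℤ) : SuperMod where
  obj V p := lineSections n V p
  res {U V} h p :=
    { toFun := fun s => ⟨(Hol.res (chart0_mono h) s.1.1, Hol.res (chart1_mono h) s.1.2),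
        congrArg (Hol.res (overlap_mono h)) s.2.1, fun hp => by
          rw [s.2.2 hp, Prod.fst_zero, Prod.snd_zero, map_zero, map_zero]; rfl⟩
      map_add' := fun _ _ => rfl
      map_smul' := fun c s => Subtype.ext (Prod.ext (map_smul _ c _) (map_smul _ c _)) }
  res_smul h _ f s := Subtype.ext (Prod.ext (map_mul (Hol.res (chart0_mono h)) _ _)
    (map_mul (Hol.res (chart1_mono h)) _ _))
  res_refl _ _ _ := rfl
  res_trans _ _ _ _ := rfl

/-! ## The projective superspace `ℙ^{1|1}` -/

/-- Superfunctions `a + b θ` on an open subset of `ℂ^{1|1}`. With a single odd coordinate `θ` the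
underlying ring is that of dual numbers; `a` is the even part and `b θ` the odd part. -/
abbrev SFun (W : Opens ℂ) : Type := DualNumber (Hol W)

/-- Pull-back `a + b θ ↦ φ*a + φ*b · m θ` along the map of superdomains `z ↦ φ`, `θ ↦ m θ`. -/
noncomputable def SFun.pull {W W' : Opens ℂ} (φ : Hol W →ₐ[ℂ] Hol W') (m : Hol W') : SFun W →+* SFun W' where
  toFun s := TrivSqZeroExt.inl (φ s.fst) + TrivSqZeroExt.inr (φ s.snd * m)
  map_one' := by ext <;> simp
  map_zero' := by ext <;> simp
  map_add' s t := by
    ext1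
    · simp
    · simp [add_mul]
  map_mul' s t := by
    ext1
    · simp
    · simp
      ring

/-- Restriction of superfunctions. -/
noncomputable def SFun.res {W W' : Opens ℂ} (h : W' ≤ W) : SFun W →+* SFun W' := SFun.pull (Hol.res h) 1

theorem SFun.res_refl {W : Opens ℂ} (s : SFun W) : SFun.res (le_refl W) s = s := by
  ext1
  · simp [SFun.res, SFun.pull]
    rfl
  · simp [SFun.res, SFun.pull]
    rfl

theorem SFun.res_res {W W' W'' : Opens ℂ} (h : W'' ≤ W') (h' : W' ≤ W) (s : SFun W) :
    SFun.res h (SFun.res h' s) = SFun.res (h.trans h') s := by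
  ext1
  · simp [SFun.res, SFun.pull]
    rfl
  · simp [SFun.res, SFun.pull]
    rfl

theorem SFun.res_smul_aux0 {U V : Opens P1} (h : U ≤ V) (f : OP1 V) (s : SFun (chart0 V)) :
    SFun.res (chart0_mono h) (f • s) = OP1.res h f • SFun.res (chart0_mono h) s := by
  ext1
  · simp [SFun.res, SFun.pull, OP1.smul_def0]
    rfl
  · simp [SFun.res, SFun.pull, OP1.smul_def0]
    rfl

theorem SFun.res_smul_aux1 {U V : Opens P1} (h : U ≤ V) (f : OP1 V) (s : SFun (chart1 V)) :
    SFun.res (chart1_mono h) (f • s) = OP1.res h f • SFun.res (chart1_mono h) s := by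
  ext1
  · simp [SFun.res, SFun.pull, OP1.smul_def1]
    rfl
  · simp [SFun.res, SFun.pull, OP1.smul_def1]
    rfl

/-- The change of coordinates `z₀ = 1/z₁`, `θ₀ = θ₁/z₁` of `ℙ^{1|1}` on superfunctions, from the
coordinates of `U₀` to those of `U₁`. -/
noncomputable def SFun.toOverlap (V : Opens P1) : SFun (chart0 V) →+* SFun (overlap V) :=
  SFun.pull (Hol.toOverlap V) (Hol.res (overlap_le_Cstar V) invFn)

/-- The coordinates `(z₀, θ₀)` of `U₀` as superfunctions of the coordinates `(z₁, θ₁)` of `U₁`. -/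
noncomputable def transCoord : Fin 2 → SFun Cstar :=
  ![TrivSqZeroExt.inl invFn, TrivSqZeroExt.inr invFn]

/-- The partial derivatives `∂/∂z` (index `0`) and `∂/∂θ` (index `1`) of a superfunction. -/
noncomputable def SFun.partial {W : Opens ℂ} (j : Fin 2) (s : SFun W) : SFun W :=
  if j = 0 then TrivSqZeroExt.inl s.fst.deriv + TrivSqZeroExt.inr s.snd.deriv
  else TrivSqZeroExt.inl s.snd

/-- The parity involution `a + b θ ↦ a - b θ`. -/
noncomputable def SFun.invol (W : Opens ℂ) : SFun W →+* SFun W := SFun.pull (AlgHom.id ℂ _) (-1)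

/-! ## Locally free sheaves on `ℙ^{1|1}` -/

/-- Gluing data of a locally free sheaf on `ℙ^{1|1}` that is free over `U₀` and over `U₁`: the
parities of its local generators and the transition matrix `M`, in the coordinates of `U₁`, of the
change of frame `e⁽⁰⁾ᵢ = ∑ⱼ Mᵢⱼ e⁽¹⁾ⱼ` on `U₀ ∩ U₁`. The sheaf glued from these data is locally free
when `M` is invertible and parity preserving, as are all the matrices formed below. -/
structure LocFree (ι : Type) where
  par : ι → ZMod 2
  M : Matrix ι ι (SFun Cstar)

/-- The coefficient `s` has parity `p`. -/
def SFun.HasParity {W : Opens ℂ} (p : ZMod 2) (s : SFun W) : Prop :=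
  (p = 0 → s.snd = 0) ∧ (p = 1 → s.fst = 0)

namespace LocFree

variable {ι κ : Type}

/-- Sections of parity `p` over `V`: pairs of coefficient vectors in the frames over `U₀` and `U₁`,
glued by the transition matrix. The coefficient of a generator of parity `q` has parity `p + q`. -/
noncomputable def sections [Fintype ι] (E : LocFree ι) (V : Opens P1) (p : ZMod 2) :
    Submodule (OP1 V) ((ι → SFun (chart0 V)) × (ι → SFun (chart1 V))) where
  carrier := {s | (∀ i, (s.1 i).HasParity (p + E.par i)) ∧ (∀ i, (s.2 i).HasParity (p + E.par i)) ∧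
    ∀ j, SFun.res (overlap_le_chart1 V) (s.2 j) =
      ∑ i, SFun.toOverlap V (s.1 i) * SFun.res (overlap_le_Cstar V) (E.M i j)}
  add_mem' := by
    rintro s t ⟨hs0, hs1, hs⟩ ⟨ht0, ht1, ht⟩
    refine ⟨fun i => ⟨fun h => ?_, fun h => ?_⟩, fun i => ⟨fun h => ?_, fun h => ?_⟩, fun j => ?_⟩
    · simp [(hs0 i).1 h, (ht0 i).1 h]
    · simp [(hs0 i).2 h, (ht0 i).2 h]
    · simp [(hs1 i).1 h, (ht1 i).1 h]
    · simp [(hs1 i).2 h, (ht1 i).2 h]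
    · simp only [Prod.fst_add, Prod.snd_add, Pi.add_apply, map_add, add_mul,
        Finset.sum_add_distrib, hs j, ht j]
  zero_mem' := ⟨fun i => ⟨fun _ => rfl, fun _ => rfl⟩, fun i => ⟨fun _ => rfl, fun _ => rfl⟩,
    fun j => by simp⟩
  smul_mem' := by
    rintro f s ⟨hs0, hs1, hs⟩
    have hf := OP1.glue f
    refine ⟨fun i => ⟨fun h => ?_, fun h => ?_⟩, fun i => ⟨fun h => ?_, fun h => ?_⟩, fun j => ?_⟩
    · simp [(hs0 i).1 h]
    · simp [(hs0 i).2 h]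
    · simp [(hs1 i).1 h]
    · simp [(hs1 i).2 h]
    · have h1 : ∀ i, (f • s).1 i = TrivSqZeroExt.inl (OP1.in0 V f) * s.1 i := fun i => by
        rw [TrivSqZeroExt.inl_mul_eq_smul]; rfl
      have h2 : ∀ i, (f • s).2 i = TrivSqZeroExt.inl (OP1.in1 V f) * s.2 i := fun i => by
        rw [TrivSqZeroExt.inl_mul_eq_smul]; rfl
      have h3 : SFun.toOverlap V (TrivSqZeroExt.inl (OP1.in0 V f)) =
          SFun.res (overlap_le_chart1 V) (TrivSqZeroExt.inl (OP1.in1 V f)) := by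
        ext1
        · simpa [SFun.toOverlap, SFun.res, SFun.pull] using hf
        · simp [SFun.toOverlap, SFun.res, SFun.pull]
      simp only [h1, h2, map_mul, hs j, h3, Finset.mul_sum, mul_assoc]

theorem res_mem [Fintype ι] (E : LocFree ι) {U V : Opens P1} (h : U ≤ V) (p : ZMod 2)
    {s : (ι → SFun (chart0 V)) × (ι → SFun (chart1 V))} (hs : s ∈ E.sections V p) :
    ((fun i => SFun.res (chart0_mono h) (s.1 i), fun i => SFun.res (chart1_mono h) (s.2 i)) :
      (ι → SFun (chart0 U)) × (ι → SFun (chart1 U))) ∈ E.sections U p := by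
  obtain ⟨hs0, hs1, hs⟩ := hs
  refine ⟨fun i => ⟨fun hp => ?_, fun hp => ?_⟩, fun i => ⟨fun hp => ?_, fun hp => ?_⟩, fun j => ?_⟩
  · simp [SFun.res, SFun.pull, (hs0 i).1 hp]
  · simp [SFun.res, SFun.pull, (hs0 i).2 hp]
  · simp [SFun.res, SFun.pull, (hs1 i).1 hp]
  · simp [SFun.res, SFun.pull, (hs1 i).2 hp]
  · have key := congrArg (SFun.res (overlap_mono h)) (hs j)
    rw [map_sum] at key
    have hone : ∀ {W W' : Opens ℂ} (k : W' ≤ W), Hol.res k 1 = 1 := fun k => map_one _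
    refine Eq.trans (Eq.trans ?_ key) (Finset.sum_congr rfl fun i _ => ?_)
    · ext1
      · simp [SFun.res, SFun.pull]
        rfl
      · simp [SFun.res, SFun.pull]
        rfl
    · rw [map_mul]
      congr 1
      · ext1
        · simp [SFun.res, SFun.toOverlap, SFun.pull]
          rfl
        · simp [SFun.res, SFun.toOverlap, SFun.pull]
          rfl
      · ext1
        · simp [SFun.res, SFun.pull]
          rfl
        · simp [SFun.res, SFun.pull]
          rfl

/-- The locally free sheaf as a sheaf of `ℤ/2`-graded modules over the structure sheaf of the
projective line (through the projection `ℙ^{1|1} → ℙ¹`). -/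
noncomputable def sheaf [Fintype ι] (E : LocFree ι) : SuperMod where
  obj V p := E.sections V p
  res {U V} h p :=
    { toFun := fun s => ⟨(fun i => SFun.res (chart0_mono h) (s.1.1 i),
        fun i => SFun.res (chart1_mono h) (s.1.2 i)), E.res_mem h p s.2⟩
      map_add' := fun s t => by
        refine Subtype.ext (Prod.ext (funext fun i => ?_) (funext fun i => ?_)) <;> exact map_add _ _ _
      map_smul' := fun c s => by
        refine Subtype.ext (Prod.ext (funext fun i => ?_) (funext fun i => ?_)) <;>
        · ext1 <;> simp [SFun.res, SFun.pull] }
  res_smul h p f s := by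
    refine Subtype.ext (Prod.ext (funext fun i => ?_) (funext fun i => ?_))
    · exact (SFun.res_smul_aux0 h f (s.1.1 i))
    · exact (SFun.res_smul_aux1 h f (s.1.2 i))
  res_refl V p s := by
    refine Subtype.ext (Prod.ext (funext fun i => ?_) (funext fun i => ?_)) <;>
    exact SFun.res_refl _
  res_trans h h' p s := by
    refine Subtype.ext (Prod.ext (funext fun i => ?_) (funext fun i => ?_)) <;>
    exact SFun.res_res _ _ _

/-- Reversal of parity: the generators `e` are replaced by `π e`, of opposite parity. -/
def Pi (E : LocFree ι) : LocFree ι := ⟨fun i => E.par i + 1, E.M⟩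

/-- The dual sheaf; its transition matrix is the supertranspose
`(A, B; C, D) ↦ (Aᵗ, Cᵗ; -Bᵗ, Dᵗ)` of the inverse of the given one. -/
noncomputable def dual [Fintype ι] [DecidableEq ι] (E : LocFree ι) : LocFree ι where
  par := E.par
  M := Matrix.of fun i j => (if E.par i = 1 ∧ E.par j = 0 then -1 else 1) * (E.M⁻¹) j i

/-- The tensor product; moving a coefficient past a generator produces the Koszul sign:
`(m eⱼ) ⊗ (n f_b) = (-1)^{|n||eⱼ|} m n (eⱼ ⊗ f_b)`. -/
noncomputable def tensor (E : LocFree ι) (F : LocFree κ) : LocFree (ι × κ) where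
  par x := E.par x.1 + F.par x.2
  M := Matrix.of fun x y => E.M x.1 y.1 *
    (if E.par y.1 = 0 then F.M x.2 y.2 else SFun.invol Cstar (F.M x.2 y.2))

/-- The Berezinian sheaf of `E`: it has one generator, of parity `p + q` if `E` has rank `p|q`, and
it transforms with the Berezinian `det (A - B D⁻¹ C) (det D)⁻¹` of the transition matrix of `E`. -/
noncomputable def ber [Fintype ι] [DecidableEq ι] (E : LocFree ι) : LocFree Unit where
  par _ := Fintype.card ι
  M := Matrix.of fun _ _ =>
    let A := E.M.toBlock (fun i => E.par i = 0) (fun i => E.par i = 0)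
    let B := E.M.toBlock (fun i => E.par i = 0) (fun i => E.par i = 1)
    let C := E.M.toBlock (fun i => E.par i = 1) (fun i => E.par i = 0)
    let D := E.M.toBlock (fun i => E.par i = 1) (fun i => E.par i = 1)
    (A - B * D⁻¹ * C).det * Ring.inverse D.det

end LocFree

/-! ### Supersymmetric powers in rank `1|1` -/

/-- Elements `P + Q f` of the free supercommutative algebra over the superfunctions on `W` generated
by an even variable `e` and an odd variable `f`, where `P` and `Q` are polynomials in `e` with
coefficients on the left. -/
structure SuperPoly (W : Opens ℂ) where
  P : Polynomial (SFun W)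
  Q : Polynomial (SFun W)

namespace SuperPoly

/-- `(P + Q f)(P' + Q' f) = P P' + (P Q' + Q P'^σ) f`, where `σ` is the parity involution of the
coefficients: `f c = (-1)^{|c|} c f` and `f² = 0`. -/
noncomputable def mul {W : Opens ℂ} (x y : SuperPoly W) : SuperPoly W :=
  ⟨x.P * y.P, x.P * y.Q + x.Q * y.P.map (SFun.invol W)⟩

/-- Powers in the free supercommutative algebra. -/
noncomputable def pow {W : Opens ℂ} (x : SuperPoly W) : ℕ → SuperPoly W
  | 0 => ⟨1, 0⟩
  | n + 1 => (pow x n).mul x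

/-- The linear element `a e + b f`. -/
noncomputable def lin {W : Opens ℂ} (a b : SFun W) : SuperPoly W :=
  ⟨Polynomial.C a * Polynomial.X, Polynomial.C b⟩

/-- The coefficient of the monomial `eⁿ f^b`, where `b` is `0` or `1`. -/
noncomputable def coeff {W : Opens ℂ} (x : SuperPoly W) (n : ℕ) (b : Fin 2) : SFun W :=
  if b = 0 then x.P.coeff n else x.Q.coeff n

end SuperPoly

/-- The monomials `e^{k-b} f^b` of degree `k` in an even variable `e` and an odd variable `f`; they are
indexed by the exponent `b` of `f`. -/
abbrev SymIdx (k : ℕ) : Type := {b : Fin 2 // (b : ℕ) ≤ k}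

/-- The `k`-th supersymmetric power of a sheaf of rank `1|1` whose generator with index `1` is even
and whose generator with index `0` is odd. Writing `e`, `f` for these generators, `Sym^k` is freely
generated by the monomials `e^{k-b} f^b`, and a change of frame acts on them multiplicatively. -/
noncomputable def LocFree.sym (E : LocFree (Fin 2)) (k : ℕ) : LocFree (SymIdx k) where
  par b := ((b.1 : ℕ) : ZMod 2)
  M := Matrix.of fun b b' =>
    (((SuperPoly.lin (E.M 1 1) (E.M 1 0)).pow (k - (b.1 : ℕ))).mul
      ((SuperPoly.lin (E.M 0 1) (E.M 0 0)).pow (b.1 : ℕ))).coeff (k - (b'.1 : ℕ)) b'.1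

/-! ### The sheaves of the Large Hilbert Space -/

/-- The structure sheaf of `ℙ^{1|1}`. -/
noncomputable def structSheaf : LocFree Unit := ⟨fun _ => 0, 1⟩

/-- The cotangent sheaf, with generators `dz` (index `0`, even) and `dθ` (index `1`, odd), which
transform with the Jacobian of the change of coordinates. -/
noncomputable def cotangent : LocFree (Fin 2) :=
  ⟨![0, 1], Matrix.of fun i j => (transCoord i).partial j⟩

/-- The tangent sheaf, with generators `∂_z` (index `0`, even) and `∂_θ` (index `1`, odd). -/
noncomputable def tangent : LocFree (Fin 2) := cotangent.dual

/-- The sheaf `Sym^k Π𝒯*` of superforms of degree `k`. -/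
noncomputable def superforms (k : ℕ) : LocFree (SymIdx k) := cotangent.Pi.sym k

/-- The sheaf `Sym^k Π𝒯`. -/
noncomputable def polyvectors (k : ℕ) : LocFree (SymIdx k) := tangent.Pi.sym k

/-- The Berezinian sheaf of `ℙ^{1|1}`, the dual of the Berezinian of `Π𝒯*`. -/
noncomputable def berP11 : LocFree Unit := cotangent.Pi.ber.dual

/-- The Large Hilbert Space of `ℙ^{1|1}` in degree `k`. -/
noncomputable def LHS (k : ℤ) : SuperMod :=
  if 0 < k then (superforms k.natAbs).sheaf
  else if k = 0 then (structSheaf.sheaf.sum berP11.Pi.sheaf).sum berP11.sheaf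
  else ((berP11.Pi.tensor (polyvectors k.natAbs)).sheaf).sum
    (berP11.tensor (polyvectors k.natAbs)).sheaf

/-! Fix a parity `p`. Since there is only one odd coordinate, the coefficient of each generator in a
section of parity `p` is either `a` or `bθ`, hence a single holomorphic function. The part of parity
`p` of a locally free sheaf on ℙ^{1|1} is therefore an ordinary vector bundle on ℙ¹, with one frame
element for each generator. Its transition matrix `LocFree.red` is read off from the given one by
inserting `θ₀ = w⁻¹θ₁` at the odd coefficients.

It remains to factor these matrices à la Birkhoff: once `N(w) Q(w) = wⁿ P(1/w)` with `P`, `Q`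
invertible and entire, the part is a sum of copies of 𝒪(n) (`LocFree.partIsoCopies`). In rank one
only a sign has to be removed: the structure sheaf gives 𝒪 and 𝒪(-1), and the Berezinian sheaf, with
transition function `-w⁻¹`, gives 𝒪(-1) and 𝒪(-2). For the symmetric powers the matrices are 2×2 and
triangular. In one parity they are diagonal with entries `±wⁿ`. In the other the diagonal entries
are, up to sign and order, `w^{n+1}` and `w^{n-1}`, with a nonzero multiple of `wⁿ` off the
diagonal; this is the nonsplit extension, whose middle term is again 𝒪(n)². Here `n = -k-1` for
superforms (`superforms_partIso_zero`, `superforms_partIso_one`) and `n = k-1` for the twisted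
polyvectors (`partIso_of_ber_tensor`).

The cohomology of 𝒪(n) comes from the Laurent splitting `exists_entire_add_entire_inv`, Taylor
expansion with an entire remainder, and Liouville's theorem in the form `eq_zero_of_entire_eq_inv`.
-/

/-! ## Entire functions and functions on the punctured plane -/

/-- The Cauchy integral of `f` over the circle of radius `r` around `0`. -/
noncomputable def cauchyIntegral (f : ℂ → ℂ) (r : ℝ) (w : ℂ) : ℂ :=
  (2 * Real.pi * Complex.I : ℂ)⁻¹ • ∮ z in C(0, r), (z - w)⁻¹ • f z

theorem continuous_eq_of_eq_off_zero {f g : ℂ → ℂ} (hf : Continuous f) (hg : Continuous g)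
    (h : ∀ z, z ≠ 0 → f z = g z) : f = g :=
  hf.ext_on (dense_compl_singleton (0 : ℂ)) hg fun z hz => h z hz

theorem circleIntegral_eq_of_differentiableOn_punctured {f : ℂ → ℂ} {r R : ℝ} (hr : 0 < r)
    (hR : r ≤ R) (hf : ∀ z : ℂ, r ≤ ‖z‖ → ‖z‖ ≤ R → DifferentiableAt ℂ f z) :
    (∮ z in C(0, R), f z) = ∮ z in C(0, r), f z := by
  refine Complex.circleIntegral_eq_of_differentiable_on_annulus_off_countable hr hR
    Set.countable_empty (fun z hz => ?_) (fun z hz => ?_)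
  · simp only [Set.mem_sdiff, Metric.mem_closedBall, dist_zero_right, Metric.mem_ball, not_lt] at hz
    exact (hf z hz.2 hz.1).continuousAt.continuousWithinAt
  · simp only [Set.mem_sdiff, Metric.mem_closedBall, dist_zero_right, Metric.mem_ball, not_le] at hz
    exact hf z hz.1.2.le hz.1.1.le

theorem ne_zero_of_pos_le_norm {z : ℂ} {r : ℝ} (hr : 0 < r) (hz : r ≤ ‖z‖) : z ≠ 0 :=
  norm_pos_iff.1 (hr.trans_le hz)

theorem differentiableAt_of_punctured {f : ℂ → ℂ} (hf : DifferentiableOn ℂ f {0}ᶜ) {z : ℂ}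
    (hz : z ≠ 0) : DifferentiableAt ℂ f z :=
  (hf z hz).differentiableAt (isOpen_compl_singleton.mem_nhds hz)

/-- The integrand is singular only at `0` and `w`, neither of which lies in the closed annulus
between the circles. The radius may thus vary as long as the circle does not cross `w`. -/
theorem cauchyIntegral_eq_of_notMem_annulus {f : ℂ → ℂ} (hf : DifferentiableOn ℂ f {0}ᶜ) {r R : ℝ}
    (hr : 0 < r) (hR : r ≤ R) {w : ℂ} (hw : ‖w‖ < r ∨ R < ‖w‖) :
    cauchyIntegral f R w = cauchyIntegral f r w := by
  unfold cauchyIntegral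
  congr 1
  refine circleIntegral_eq_of_differentiableOn_punctured hr hR fun z hz1 hz2 => ?_
  have hne : z - w ≠ 0 := by
    rw [sub_ne_zero]
    rintro rfl
    rcases hw with h | h <;> linarith
  exact ((differentiableAt_id.sub_const w).inv hne).smul
    (differentiableAt_of_punctured hf (ne_zero_of_pos_le_norm hr hz1))

theorem circleIntegral_sub_inv_of_lt_norm {r : ℝ} (hr : 0 < r) {w : ℂ} (hw : r < ‖w‖) :
    (∮ z in C(0, r), (z - w)⁻¹) = 0 := by
  have hne : ∀ z ∈ Metric.closedBall (0 : ℂ) r, z - w ≠ 0 := fun z hz => by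
    rw [sub_ne_zero]
    rintro rfl
    rw [Metric.mem_closedBall, dist_zero_right] at hz
    linarith
  refine Complex.circleIntegral_eq_zero_of_differentiable_on_off_countable hr.le
    Set.countable_empty (fun z hz => ?_) (fun z hz => ?_)
  · exact ((continuousAt_id.sub continuousAt_const).inv₀ (hne z hz)).continuousWithinAt
  · exact (differentiableAt_id.sub_const w).inv (hne z (Metric.ball_subset_closedBall hz.1))

/-- The difference quotient extends holomorphically across a nonzero `w`, which neither term on the
right does, so its integral can be moved across `w`. -/
theorem circleIntegral_dslope {f : ℂ → ℂ} (hf : DifferentiableOn ℂ f {0}ᶜ) {r : ℝ} (hr : 0 < r)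
    {w : ℂ} (hw : ‖w‖ ≠ r) :
    (∮ z in C(0, r), dslope f w z) =
      (∮ z in C(0, r), (z - w)⁻¹ • f z) - (∮ z in C(0, r), (z - w)⁻¹) * f w := by
  have hne : ∀ z ∈ Metric.sphere (0 : ℂ) r, z - w ≠ 0 := fun z hz => by
    rw [sub_ne_zero]
    rintro rfl
    exact hw (by simpa using hz)
  have hinv : ContinuousOn (fun z : ℂ => (z - w)⁻¹) (Metric.sphere 0 r) :=
    (continuousOn_id.sub continuousOn_const).inv₀ hne
  have hfc : ContinuousOn f (Metric.sphere 0 r) := hf.continuousOn.mono fun z hz => by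
    have : ‖z‖ = r := by simpa using hz
    exact ne_zero_of_pos_le_norm hr this.ge
  have hmul : (∮ z in C(0, r), (z - w)⁻¹) * f w = ∮ z in C(0, r), (z - w)⁻¹ • f w :=
    (circleIntegral.integral_smul_const (fun z => (z - w)⁻¹) (f w) 0 r).symm
  rw [hmul, ← circleIntegral.integral_sub (f := fun z => (z - w)⁻¹ • f z) (g := fun z => (z - w)⁻¹ • f w)
    ((hinv.smul hfc).circleIntegrable hr.le)
    ((hinv.smul continuousOn_const).circleIntegrable hr.le)]
  refine circleIntegral.integral_congr hr.le fun z hz => ?_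
  rw [dslope_of_ne _ (sub_ne_zero.1 (hne z hz)), slope_def_module, smul_sub]

/-- Cauchy's formula on an annulus: `dslope f w` has the same integral over both circles, and of the
two winding terms only the outer one, `2πi`, is nonzero. -/
theorem cauchyIntegral_sub_cauchyIntegral {f : ℂ → ℂ} (hf : DifferentiableOn ℂ f {0}ᶜ) {r R : ℝ}
    (hr : 0 < r) {w : ℂ} (hrw : r < ‖w‖) (hwR : ‖w‖ < R) :
    cauchyIntegral f R w - cauchyIntegral f r w = f w := by
  have hw0 : w ≠ 0 := ne_zero_of_pos_le_norm hr hrw.le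
  have hd : DifferentiableOn ℂ (dslope f w) {0}ᶜ :=
    (Complex.differentiableOn_dslope (isOpen_compl_singleton.mem_nhds hw0)).2 hf
  have key : (∮ z in C(0, R), dslope f w z) = ∮ z in C(0, r), dslope f w z :=
    circleIntegral_eq_of_differentiableOn_punctured hr (hrw.trans hwR).le fun z hz _ =>
      differentiableAt_of_punctured hd (ne_zero_of_pos_le_norm hr hz)
  rw [circleIntegral_dslope hf hr hrw.ne', circleIntegral_dslope hf (hr.trans (hrw.trans hwR))
    hwR.ne, circleIntegral_sub_inv_of_lt_norm hr hrw,
    circleIntegral.integral_sub_inv_of_mem_ball (by simpa using hwR)] at key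
  unfold cauchyIntegral
  rw [← smul_sub, sub_eq_of_eq_add (by linear_combination key :
    _ = 2 * Real.pi * Complex.I * f w + _), smul_eq_mul,
    inv_mul_cancel_left₀ Complex.two_pi_I_ne_zero]

theorem differentiableAt_cauchyIntegral {f : ℂ → ℂ} (hf : DifferentiableOn ℂ f {0}ᶜ) {r : ℝ}
    (hr : 0 < r) {w : ℂ} (hw : ‖w‖ < r) : DifferentiableAt ℂ (cauchyIntegral f r) w := by
  lift r to NNReal using hr.le
  have hc : CircleIntegrable f 0 r := (hf.continuousOn.mono fun z hz => by
    have : ‖z‖ = r := by simpa using hz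
    exact ne_zero_of_pos_le_norm hr this.ge).circleIntegrable hr.le
  refine (hasFPowerSeriesOn_cauchy_integral hc (by exact_mod_cast hr)).differentiableOn.differentiableAt
    (Metric.isOpen_eball.mem_nhds ?_)
  simpa [Metric.mem_eball, edist_zero_right, ← ENNReal.coe_lt_coe] using hw

/-- A holomorphic function on the punctured plane is the sum of an entire function of `w` and an
entire function of `1/w`. -/
theorem exists_entire_add_entire_inv {F : ℂ → ℂ} (hF : DifferentiableOn ℂ F {0}ᶜ) :
    ∃ g u : ℂ → ℂ, Differentiable ℂ g ∧ Differentiable ℂ u ∧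
      ∀ w, w ≠ 0 → F w = g w + u w⁻¹ := by
  let g : ℂ → ℂ := fun w => cauchyIntegral F (‖w‖ + 1) w
  -- For `x` near `w` the varying radius `‖x‖ + 1` may be replaced by the fixed radius `‖w‖ + 2`,
  -- since both circles enclose `x`.
  have hg : Differentiable ℂ g := fun w => by
    refine (differentiableAt_cauchyIntegral hF (r := ‖w‖ + 2) (by positivity)
      (by linarith)).congr_of_eventuallyEq ?_
    filter_upwards [Metric.ball_mem_nhds w one_pos] with x hx
    have hx' : ‖x‖ < ‖w‖ + 1 := by
      have := norm_le_norm_add_norm_sub' x w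
      rw [Metric.mem_ball, dist_eq_norm] at hx
      linarith
    exact (cauchyIntegral_eq_of_notMem_annulus hF (by positivity) (by linarith)
      (Or.inl (by linarith))).symm
  -- The principal part, in the variable `z = 1/w`. Near `z = 0` it is minus a Cauchy integral over
  -- the unit circle, so it is bounded and its singularity is removable.
  let v : ℂ → ℂ := fun z => F z⁻¹ - g z⁻¹
  have hinv : DifferentiableOn ℂ (fun z : ℂ => z⁻¹) {0}ᶜ := differentiableOn_inv
  have hv : DifferentiableOn ℂ v {0}ᶜ :=
    (hF.comp hinv fun z hz => inv_ne_zero hz).sub (hg.comp_differentiableOn hinv)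
  obtain ⟨B, hB⟩ := ((isCompact_sphere (0 : ℂ) 1).image_of_continuousOn
    (hF.continuousOn.mono fun z hz => by
      have : ‖z‖ = 1 := by simpa using hz
      exact ne_zero_of_pos_le_norm one_pos this.ge)).isBounded.exists_norm_le
  -- The factors are the radius `1`, the bound `1` for the kernel (as `‖z⁻¹‖ > 2` while `‖x‖ = 1`),
  -- and the bound `B` for `F` on the unit circle.
  have hbound : ∀ z : ℂ, z ≠ 0 → ‖z‖ < 1 / 2 → ‖v z‖ ≤ 1 * (1 * B) := fun z hz hz2 => by
    have h1 : 2 < ‖z⁻¹‖ := by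
      rw [norm_inv, lt_inv_comm₀ two_pos (norm_pos_iff.2 hz)]
      linarith
    have h2 : v z = - cauchyIntegral F 1 z⁻¹ := by
      have := cauchyIntegral_sub_cauchyIntegral hF one_pos (w := z⁻¹) (R := ‖z⁻¹‖ + 1)
        (by linarith) (by linarith)
      simp only [v, g]
      linear_combination -this
    rw [h2, norm_neg]
    refine circleIntegral.norm_two_pi_i_inv_smul_integral_le_of_norm_le_const zero_le_one
      fun x hx => ?_
    rw [norm_smul]
    refine mul_le_mul ?_ (hB _ ⟨x, hx, rfl⟩) (norm_nonneg _) zero_le_one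
    rw [norm_inv]
    refine inv_le_one_of_one_le₀ ?_
    have h3 : ‖x‖ = 1 := by simpa using hx
    have := norm_le_norm_add_norm_sub' z⁻¹ x
    rw [norm_sub_rev] at this
    linarith
  let u : ℂ → ℂ := Function.update v 0 (Filter.limUnder (nhdsWithin 0 {0}ᶜ) v)
  have hu0 : ∀ z, z ≠ 0 → u z = v z := fun z hz => Function.update_of_ne hz _ _
  have hball : Metric.ball (0 : ℂ) (1 / 2) ∈ nhds (0 : ℂ) := Metric.ball_mem_nhds _ (by norm_num)
  refine ⟨g, u, hg, fun z => ?_, fun w hw => ?_⟩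
  · by_cases hz : z = 0
    · subst hz
      refine (Complex.differentiableOn_update_limUnder_of_bddAbove hball
        (hv.mono fun z hz => hz.2) ⟨1 * (1 * B), ?_⟩).differentiableAt hball
      rintro _ ⟨z, hz, rfl⟩
      exact hbound z hz.2 (by simpa using hz.1)
    · refine (differentiableAt_of_punctured hv hz).congr_of_eventuallyEq ?_
      filter_upwards [isOpen_compl_singleton.mem_nhds hz] with x hx
      exact hu0 x hx
  · rw [hu0 _ (inv_ne_zero hw)]
    simp [v]

/-! ### Taylor polynomials with remainder, and Liouville's theorem -/

theorem exists_eq_sum_add_pow_mul {f : ℂ → ℂ} (hf : Differentiable ℂ f) (n : ℕ) :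
    ∃ (a : Fin n → ℂ) (h : ℂ → ℂ), Differentiable ℂ h ∧
      ∀ z, f z = ∑ i, a i * z ^ (i : ℕ) + z ^ n * h z := by
  induction n generalizing f with
  | zero => exact ⟨0, f, hf, fun z => by simp⟩
  | succ n ih =>
    -- Away from `0`, `dslope f 0` is `(f z - f 0) / z`; each induction step peels off one Taylor
    -- coefficient.
    have hd : Differentiable ℂ (dslope f 0) := by
      rw [← differentiableOn_univ, Complex.differentiableOn_dslope Filter.univ_mem]
      exact hf.differentiableOn
    obtain ⟨a, h, hh, H⟩ := ih hd
    refine ⟨Fin.cons (f 0) a, h, hh, fun z => ?_⟩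
    have h1 := sub_smul_dslope f 0 z
    rw [H z, sub_zero, smul_eq_mul, mul_add, Finset.mul_sum] at h1
    rw [Fin.sum_univ_succ]
    simp only [Fin.cons_zero, Fin.val_zero, pow_zero, mul_one, Fin.cons_succ, Fin.val_succ]
    rw [eq_add_of_sub_eq h1.symm, Finset.sum_congr rfl fun i _ =>
      (by ring : z * (a i * z ^ (i : ℕ)) = a i * z ^ ((i : ℕ) + 1))]
    ring

/-- The constant term is read off at `0`; then both sides are divided by `z`, and continuity
restores the identity at `z = 0`. -/
theorem eq_zero_of_sum_eq_pow_mul {n : ℕ} {a : Fin n → ℂ} {f : ℂ → ℂ} (hf : Continuous f)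
    (h : ∀ z, ∑ i, a i * z ^ (i : ℕ) = z ^ n * f z) : a = 0 := by
  induction n with
  | zero => exact Subsingleton.elim _ _
  | succ n ih =>
    have h0 : a 0 = 0 := by simpa [Fin.sum_univ_succ] using h 0
    have h1 : ∀ z, ∑ i, a (Fin.succ i) * z ^ (i : ℕ) = z ^ n * f z := by
      refine fun z => congrFun (continuous_eq_of_eq_off_zero (f := fun z => ∑ i, a (Fin.succ i) *
        z ^ (i : ℕ)) (g := fun z => z ^ n * f z) (by fun_prop) (by fun_prop) fun z hz => ?_) z
      refine mul_left_cancel₀ hz ?_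
      have := h z
      rw [Fin.sum_univ_succ, h0] at this
      simp only [Fin.val_succ, zero_mul, zero_add] at this
      rw [Finset.mul_sum, Finset.sum_congr rfl fun i _ =>
        (by ring : z * (a (Fin.succ i) * z ^ (i : ℕ)) = a (Fin.succ i) * z ^ ((i : ℕ) + 1)), this]
      ring
    have h2 := ih h1
    funext i
    refine Fin.cases h0 (fun j => congrFun h2 j) i

/-- An entire function of `w` that equals `w⁻¹` times an entire function of `w⁻¹` vanishes, and so
does the latter. -/
theorem eq_zero_of_entire_eq_inv {g f : ℂ → ℂ} (hg : Differentiable ℂ g) (hf : Continuous f)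
    (h : ∀ w, w ≠ 0 → g w = f w⁻¹ * w⁻¹) : g = 0 ∧ f = 0 := by
  have hinv : Filter.Tendsto (fun w : ℂ => w⁻¹) (Filter.cocompact ℂ) (nhds 0) :=
    Filter.tendsto_inv₀_cobounded.mono_left Metric.cobounded_eq_cocompact.ge
  -- As `w → ∞`, `f w⁻¹` tends to `f 0` and `w⁻¹` to `0`; Liouville's theorem applies to `g`.
  have hlim : Filter.Tendsto g (Filter.cocompact ℂ) (nhds 0) := by
    have h1 := ((hf.tendsto 0).comp hinv).mul hinv
    rw [mul_zero] at h1
    refine h1.congr' ?_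
    have : ({0}ᶜ : Set ℂ) ∈ Filter.cocompact ℂ := (isCompact_singleton).compl_mem_cocompact
    filter_upwards [this] with w hw
    exact (h w hw).symm
  have hg0 : g = 0 := funext fun w => hg.apply_eq_of_tendsto_cocompact w hlim
  refine ⟨hg0, continuous_eq_of_eq_off_zero hf continuous_const fun z hz => ?_⟩
  have := h z⁻¹ (inv_ne_zero hz)
  rw [hg0, inv_inv, Pi.zero_apply] at this
  exact (mul_eq_zero.1 this.symm).resolve_right hz

/-! ## Cohomology of the line bundles on the projective line -/

theorem Hol.ext {W : Opens ℂ} {f g : Hol W} (h : ∀ z, f.1 z = g.1 z) : f = g :=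
  Subtype.ext (funext h)

theorem Hol.mul_apply {W : Opens ℂ} (f g : Hol W) (z : W) : (f * g).1 z = f.1 z * g.1 z := rfl

theorem wUnit_zpow_apply (n : ℤ) (w : Cstar) :
    ((wUnit ^ n : (Hol Cstar)ˣ) : Hol Cstar).1 w = (w : ℂ) ^ n := by
  have hpow : ∀ (u : Hol Cstar) (m : ℕ), (u ^ m).1 w = u.1 w ^ m := fun u m => rfl
  cases n with
  | ofNat m =>
    rw [Int.ofNat_eq_natCast, zpow_natCast, zpow_natCast, Units.val_pow_eq_pow_val, hpow]
    rfl
  | negSucc m =>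
    rw [zpow_negSucc, zpow_negSucc, ← inv_pow, ← inv_pow, Units.val_pow_eq_pow_val, hpow]
    rfl

/-! ### The standard open sets in the two affine coordinates -/

theorem inv_mem_chart0 {V : Opens P1} {w : ℂ} (hw : w ∈ chart1 V) (hw0 : w ≠ 0) :
    w⁻¹ ∈ chart0 V := by
  have h1 : chartInfty w ∈ V := hw
  rwa [chartInfty_of_ne hw0] at h1

theorem inv_mem_chart1 {V : Opens P1} {z : ℂ} (hz : z ∈ chart0 V) (hz0 : z ≠ 0) :
    z⁻¹ ∈ chart1 V := by
  change chartInfty z⁻¹ ∈ V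
  rw [chartInfty_of_ne (inv_ne_zero hz0), inv_inv]
  exact hz

theorem mem_chart0_U0 (z : ℂ) : z ∈ chart0 U0 := OnePoint.coe_ne_infty z

theorem mem_chart1_U1 (w : ℂ) : w ∈ chart1 U1 := by
  change chartInfty w ≠ ((0 : ℂ) : P1)
  by_cases hw : w = 0
  · simp [chartInfty, hw]
  · rw [chartInfty_of_ne hw, Ne, OnePoint.coe_eq_coe]
    exact inv_ne_zero hw

theorem mem_chart1_U0 {w : ℂ} : w ∈ chart1 U0 ↔ w ≠ 0 := by
  change chartInfty w ≠ OnePoint.infty ↔ _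
  by_cases hw : w = 0
  · simp [chartInfty, hw]
  · simp [chartInfty_of_ne hw, hw]

theorem mem_chart0_U1 {z : ℂ} : z ∈ chart0 U1 ↔ z ≠ 0 := by
  change (z : P1) ≠ ((0 : ℂ) : P1) ↔ _
  rw [Ne, OnePoint.coe_eq_coe]

theorem mem_chart0_inf {z : ℂ} : z ∈ chart0 (U0 ⊓ U1) ↔ z ≠ 0 :=
  ⟨fun h => mem_chart0_U1.1 h.2, fun h => ⟨mem_chart0_U0 z, mem_chart0_U1.2 h⟩⟩

theorem mem_chart1_inf {w : ℂ} : w ∈ chart1 (U0 ⊓ U1) ↔ w ≠ 0 :=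
  ⟨fun h => mem_chart1_U0.1 h.1, fun h => ⟨mem_chart1_U0.2 h, mem_chart1_U1 w⟩⟩

theorem mem_lineSections_zero {n : ℤ} {V : Opens P1} {s : Hol (chart0 V) × Hol (chart1 V)} :
    s ∈ lineSections n V 0 ↔ ∀ (w : ℂ) (hw : w ∈ chart1 V) (hw0 : w ≠ 0),
      s.2.1 ⟨w, hw⟩ = s.1.1 ⟨w⁻¹, inv_mem_chart0 hw hw0⟩ * w ^ n := by
  constructor
  · intro h w hw hw0
    have h1 := congrArg (fun f : Hol (overlap V) => f.1 ⟨w, hw, hw0⟩) h.1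
    refine h1.trans ?_
    rw [Hol.mul_apply]
    exact congrArg _ (wUnit_zpow_apply n ⟨w, hw0⟩)
  · intro h
    refine ⟨Hol.ext fun w => ?_, fun h0 => absurd h0 zero_ne_one⟩
    rw [Hol.mul_apply]
    refine (h w w.2.1 w.2.2).trans ?_
    exact congrArg _ (wUnit_zpow_apply n ⟨w, w.2.2⟩).symm

section LineBundle

variable {n : ℤ} {V : Opens P1}

theorem lineBundle_snd (s : (lineBundle n).obj V 0) {w : ℂ} (hw : w ∈ chart1 V) (hw0 : w ≠ 0) :
    s.1.2.1 ⟨w, hw⟩ = s.1.1.1 ⟨w⁻¹, inv_mem_chart0 hw hw0⟩ * w ^ n :=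
  mem_lineSections_zero.1 s.2 w hw hw0

/-- Inside `U₁` the coordinate `z` never vanishes, so the value at `z` is recovered from the one at
`w = 1/z` by dividing by `wⁿ`. -/
theorem lineBundle_ext_of_snd (hV : V ≤ U1) {s t : (lineBundle n).obj V 0}
    (h : ∀ w, s.1.2.1 w = t.1.2.1 w) : s = t := by
  refine Subtype.ext (Prod.ext (Hol.ext fun z => ?_) (Hol.ext h))
  have hz : (z : ℂ) ≠ 0 := mem_chart0_U1.1 (hV z.2)
  have hz' : (z : ℂ)⁻¹ ≠ 0 := inv_ne_zero hz
  have h1 := h ⟨(z : ℂ)⁻¹, inv_mem_chart1 z.2 hz⟩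
  rw [lineBundle_snd s _ hz', lineBundle_snd t _ hz'] at h1
  have h2 := mul_right_cancel₀ (zpow_ne_zero n hz') h1
  simpa only [inv_inv] using h2

theorem lineBundle_ext_of_fst (hV : V ≤ U0) {s t : (lineBundle n).obj V 0}
    (h : ∀ z, s.1.1.1 z = t.1.1.1 z) : s = t := by
  refine Subtype.ext (Prod.ext (Hol.ext h) (Hol.ext fun w => ?_))
  have hw : (w : ℂ) ≠ 0 := mem_chart1_U0.1 (hV w.2)
  rw [lineBundle_snd s w.2 hw, lineBundle_snd t w.2 hw, h]

theorem exists_entire_fst (s : (lineBundle n).obj U0 0) :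
    ∃ f : ℂ → ℂ, Differentiable ℂ f ∧ ∀ z, s.1.1.1 z = f z := by
  obtain ⟨f, hf, h⟩ := s.1.1.2
  exact ⟨f, fun z => hf.differentiableAt ((chart0 U0).isOpen.mem_nhds (mem_chart0_U0 z)),
    fun z => (h z).symm⟩

theorem exists_entire_snd (s : (lineBundle n).obj U1 0) :
    ∃ g : ℂ → ℂ, Differentiable ℂ g ∧ ∀ w, s.1.2.1 w = g w := by
  obtain ⟨f, hf, h⟩ := s.1.2.2
  exact ⟨f, fun z => hf.differentiableAt ((chart1 U1).isOpen.mem_nhds (mem_chart1_U1 z)),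
    fun z => (h z).symm⟩

theorem exists_punctured_snd (s : (lineBundle n).obj (U0 ⊓ U1) 0) :
    ∃ g : ℂ → ℂ, DifferentiableOn ℂ g {0}ᶜ ∧ ∀ w, s.1.2.1 w = g w := by
  obtain ⟨f, hf, h⟩ := s.1.2.2
  exact ⟨f, hf.mono fun w hw => mem_chart1_inf.2 hw, fun z => (h z).symm⟩

/-- The section over `U₀` with a given entire coefficient. -/
noncomputable def lineBundleMk0 (n : ℤ) (f : ℂ → ℂ) (hf : Differentiable ℂ f) :
    (lineBundle n).obj U0 0 :=
  ⟨(⟨fun z => f z, f, hf.differentiableOn, fun _ => rfl⟩,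
    ⟨fun w => f (w : ℂ)⁻¹ * (w : ℂ) ^ n, fun w => f w⁻¹ * w ^ n,
      fun w hw => ((hf.differentiableAt.comp w
        (differentiableAt_inv (mem_chart1_U0.1 hw))).mul
          (differentiableAt_zpow.2 (Or.inl (mem_chart1_U0.1 hw)))).differentiableWithinAt,
      fun _ => rfl⟩), mem_lineSections_zero.2 fun _ _ _ => rfl⟩

/-- The section over `U₁` with a given entire coefficient. -/
noncomputable def lineBundleMk1 (n : ℤ) (g : ℂ → ℂ) (hg : Differentiable ℂ g) :
    (lineBundle n).obj U1 0 :=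
  ⟨(⟨fun z => g (z : ℂ)⁻¹ * (z : ℂ) ^ n, fun z => g z⁻¹ * z ^ n,
      fun w hw => ((hg.differentiableAt.comp w
        (differentiableAt_inv (mem_chart0_U1.1 hw))).mul
          (differentiableAt_zpow.2 (Or.inl (mem_chart0_U1.1 hw)))).differentiableWithinAt,
      fun _ => rfl⟩, ⟨fun z => g z, g, hg.differentiableOn, fun _ => rfl⟩),
    mem_lineSections_zero.2 fun w _ hw0 => by
      change g w = g (w⁻¹)⁻¹ * (w⁻¹) ^ n * w ^ n
      rw [inv_inv, inv_zpow, inv_mul_cancel_right₀ (zpow_ne_zero n hw0)]⟩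

/-- Linear combinations of given holomorphic functions. -/
noncomputable def Hol.linComb {m : ℕ} (W : Opens ℂ) (e : Fin m → ℂ → ℂ)
    (he : ∀ i, DifferentiableOn ℂ (e i) W) : (Fin m → ℂ) →ₗ[ℂ] Hol W where
  toFun a := ⟨fun z => ∑ i, a i * e i z, fun z => ∑ i, a i * e i z,
    DifferentiableOn.fun_sum fun i _ => (he i).const_mul (a i), fun _ => rfl⟩
  map_add' a b := Hol.ext fun z => by
    change ∑ i, (a i + b i) * e i z = ∑ i, a i * e i z + ∑ i, b i * e i z
    simp only [add_mul, Finset.sum_add_distrib]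
  map_smul' c a := Hol.ext fun z => by
    change ∑ i, (c * a i) * e i z = c * ∑ i, a i * e i z
    rw [Finset.mul_sum]
    exact Finset.sum_congr rfl fun i _ => mul_assoc _ _ _

/-- Linear combinations of the monomial sections `z^{q i} e₀ = w^{n - q i} e₁` of `𝒪(n)`. -/
noncomputable def monomialSections {m : ℕ} (n : ℤ) (V : Opens P1) (q : Fin m → ℤ)
    (h0 : ∀ i, DifferentiableOn ℂ (fun z : ℂ => z ^ q i) (chart0 V))
    (h1 : ∀ i, DifferentiableOn ℂ (fun w : ℂ => w ^ (n - q i)) (chart1 V)) :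
    (Fin m → ℂ) →ₗ[ℂ] (lineBundle n).obj V 0 where
  toFun a := ⟨(Hol.linComb _ _ h0 a, Hol.linComb _ _ h1 a), mem_lineSections_zero.2 fun w _ hw0 => by
    change ∑ i, a i * w ^ (n - q i) = (∑ i, a i * (w⁻¹) ^ q i) * w ^ n
    rw [Finset.sum_mul]
    refine Finset.sum_congr rfl fun i _ => ?_
    rw [zpow_sub₀ hw0, inv_zpow]
    ring⟩
  map_add' a b := Subtype.ext (Prod.ext (map_add _ a b) (map_add _ a b))
  map_smul' c a := Subtype.ext (Prod.ext (map_smul _ c a) (map_smul _ c a))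

end LineBundle

/-! ### Čech cohomology of 𝒪(n) -/

theorem mem_ker_cechD {F : SuperMod} {p : ZMod 2} {s : F.obj U0 p × F.obj U1 p} :
    s ∈ LinearMap.ker (F.cechD p) ↔ F.res inf_le_right p s.2 = F.res inf_le_left p s.1 := by
  rw [LinearMap.mem_ker]
  exact sub_eq_zero

theorem lineBundle_ker_snd {n : ℤ} {s : (lineBundle n).obj U0 0 × (lineBundle n).obj U1 0}
    (hs : s ∈ LinearMap.ker ((lineBundle n).cechD 0)) {f g : ℂ → ℂ} (hf : ∀ z, s.1.1.1.1 z = f z)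
    (hg : ∀ w, s.2.1.2.1 w = g w) {w : ℂ} (hw : w ≠ 0) : g w = f w⁻¹ * w ^ n := by
  have h1 := congrArg (fun t : (lineBundle n).obj (U0 ⊓ U1) 0 => t.1.2.1 ⟨w, mem_chart1_inf.2 hw⟩)
    (mem_ker_cechD.1 hs)
  have h2 : s.2.1.2.1 ⟨w, mem_chart1_U1 w⟩ = s.1.1.2.1 ⟨w, mem_chart1_U0.2 hw⟩ := h1
  rw [hg, lineBundle_snd s.1 _ hw, hf] at h2
  exact h2

theorem nonempty_equiv_fin_zero (E : Type*) [AddCommGroup E] [Module ℂ E] [Subsingleton E] :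
    Nonempty (E ≃ₗ[ℂ] (Fin 0 → ℂ)) :=
  ⟨LinearEquiv.ofSubsingleton _ _⟩

/-- A global section satisfies `g w = f w⁻¹ * w^(-k-1)`. Absorbing `w⁻ᵏ` into `f` as `zᵏ` leaves
exactly the factor `w⁻¹` needed for Liouville's theorem. -/
theorem lineBundle_H0_of_neg (k : ℕ) :
    Nonempty ((lineBundle (-(k : ℤ) - 1)).H0 0 ≃ₗ[ℂ] (Fin 0 → ℂ)) := by
  have : Subsingleton ((lineBundle (-(k : ℤ) - 1)).H0 0) := by
    refine subsingleton_of_forall_eq 0 fun s => Subtype.ext ?_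
    obtain ⟨f, hf, hf'⟩ := exists_entire_fst s.1.1
    obtain ⟨g, hg, hg'⟩ := exists_entire_snd s.1.2
    obtain ⟨hg0, hf0⟩ := eq_zero_of_entire_eq_inv hg (f := fun z => f z * z ^ k)
      (hf.continuous.mul (continuous_pow k)) fun w hw => by
        rw [lineBundle_ker_snd s.2 hf' hg' hw, zpow_sub₀ hw, zpow_neg, zpow_natCast, inv_pow,
          zpow_one]
        ring
    have hf1 : f = 0 := continuous_eq_of_eq_off_zero hf.continuous continuous_const fun z hz =>
      (mul_eq_zero.1 (congrFun hf0 z)).resolve_right (pow_ne_zero k hz)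
    exact Prod.ext (lineBundle_ext_of_fst le_rfl fun z => by rw [hf', hf1]; rfl)
      (lineBundle_ext_of_snd le_rfl fun w => by rw [hg', hg0]; rfl)
  exact nonempty_equiv_fin_zero _

/-- By the Laurent splitting every cochain is a coboundary: the entire part in `w` extends over
`U₁`, and the part in `1/w` extends over `U₀`, where the change of frame only multiplies it by
`z^N`. -/
theorem lineBundle_H1_of_nonneg (N : ℕ) :
    Nonempty ((lineBundle (N : ℤ)).H1 0 ≃ₗ[ℂ] (Fin 0 → ℂ)) := by
  have : Subsingleton ((lineBundle (N : ℤ)).H1 0) := by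
    rw [Submodule.Quotient.subsingleton_iff, eq_top_iff]
    rintro s -
    obtain ⟨F, hF, hF'⟩ := exists_punctured_snd s
    obtain ⟨g, u, hg, hu, H⟩ := exists_entire_add_entire_inv hF
    refine ⟨(lineBundleMk0 N (fun z => -(u z * z ^ N)) (hu.mul (differentiable_pow N)).neg,
      lineBundleMk1 N g hg), lineBundle_ext_of_snd inf_le_right fun w => ?_⟩
    have hw : (w : ℂ) ≠ 0 := mem_chart1_inf.1 w.2
    rw [hF', H w hw]
    change g w - -(u (w : ℂ)⁻¹ * ((w : ℂ)⁻¹) ^ N) * (w : ℂ) ^ (N : ℤ) = _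
    rw [zpow_natCast, inv_pow]
    field_simp
    ring
  exact nonempty_equiv_fin_zero _

theorem lineBundle_H0_of_nonneg (N : ℕ) :
    Nonempty ((lineBundle (N : ℤ)).H0 0 ≃ₗ[ℂ] (Fin (N + 1) → ℂ)) := by
  have hd0 : ∀ V (i : Fin (N + 1)), DifferentiableOn ℂ (fun z : ℂ => z ^ (i : ℤ)) (chart0 V) :=
    fun V i z _ => (differentiableAt_zpow.2 (Or.inr (by positivity))).differentiableWithinAt
  have hd1 : ∀ V (i : Fin (N + 1)),
      DifferentiableOn ℂ (fun z : ℂ => z ^ ((N : ℤ) - (i : ℤ))) (chart1 V) :=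
    fun V i z _ => (differentiableAt_zpow.2 (Or.inr (by omega))).differentiableWithinAt
  let m := fun V => monomialSections (N : ℤ) V _ (hd0 V) (hd1 V)
  let φ : (Fin (N + 1) → ℂ) →ₗ[ℂ] (lineBundle (N : ℤ)).H0 0 :=
    ((m U0).prod (m U1)).codRestrict _ fun a => mem_ker_cechD.2 rfl
  refine ⟨(LinearEquiv.ofBijective φ ⟨?_, ?_⟩).symm⟩
  · rw [← LinearMap.ker_eq_bot, LinearMap.ker_eq_bot']
    intro a ha
    refine eq_zero_of_sum_eq_pow_mul (f := 0) continuous_zero fun z => ?_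
    have h1 := congrArg (fun s => s.1.1.1.1.1 ⟨z, mem_chart0_U0 z⟩) ha
    have h2 : ∑ i, a i * z ^ ((i : ℕ) : ℤ) = 0 := h1
    simpa only [zpow_natCast, Pi.zero_apply, mul_zero] using h2
  · intro s
    obtain ⟨f, hf, hf'⟩ := exists_entire_fst s.1.1
    obtain ⟨g, hg, hg'⟩ := exists_entire_snd s.1.2
    -- The terms up to `z^N` are the monomial sections; the remainder `z^(N+1) h` becomes `h w⁻¹ *
    -- w⁻¹` in the other frame, which Liouville's theorem forces to vanish.
    obtain ⟨a, h, hh, H⟩ := exists_eq_sum_add_pow_mul hf (N + 1)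
    have hr : Differentiable ℂ (fun w => ∑ i, a i * w ^ ((N : ℤ) - (i : ℤ))) :=
      Differentiable.fun_sum fun i _ =>
        (fun w => (differentiableAt_zpow.2 (Or.inr (by omega))).const_mul (a i))
    have key : ∀ w : ℂ, w ≠ 0 →
        g w - ∑ i, a i * w ^ ((N : ℤ) - (i : ℤ)) = h w⁻¹ * w⁻¹ := fun w hw => by
      rw [lineBundle_ker_snd s.2 hf' hg' hw, H, add_mul, Finset.sum_mul,
        Finset.sum_congr rfl fun (i : Fin (N + 1)) _ =>
          (show a i * w⁻¹ ^ (i : ℕ) * w ^ (N : ℤ) = a i * w ^ ((N : ℤ) - (i : ℤ)) by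
            rw [zpow_sub₀ hw, zpow_natCast, zpow_natCast, inv_pow, mul_assoc, div_eq_inv_mul])]
      rw [add_sub_cancel_left, zpow_natCast, pow_succ, inv_pow]
      field_simp
    obtain ⟨hg0, hh0⟩ := eq_zero_of_entire_eq_inv (hg.sub hr) hh.continuous key
    refine ⟨a, Subtype.ext (Prod.ext (lineBundle_ext_of_fst le_rfl fun z => ?_)
      (lineBundle_ext_of_snd le_rfl fun w => ?_))⟩
    · rw [hf', H, hh0]
      change ∑ i, a i * (z : ℂ) ^ ((i : ℕ) : ℤ) = _
      simp
    · rw [hg', ← sub_eq_zero, ← neg_eq_zero, neg_sub]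
      exact congrFun hg0 w

/-- In the frame over `U₁`, powers `w^j` with `j ≥ 0` extend over `U₁` and those with `j ≤ -k-1`
extend over `U₀`. The classes of `w⁻¹, …, w⁻ᵏ` remain and form a basis. -/
theorem lineBundle_H1_of_neg (k : ℕ) :
    Nonempty ((lineBundle (-(k : ℤ) - 1)).H1 0 ≃ₗ[ℂ] (Fin k → ℂ)) := by
  let m := monomialSections (-(k : ℤ) - 1) (U0 ⊓ U1) (fun i : Fin k => (i : ℤ) - k)
    (fun i z hz => (differentiableAt_zpow.2 (Or.inl (mem_chart0_inf.1 hz))).differentiableWithinAt)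
    (fun i z hz => (differentiableAt_zpow.2 (Or.inl (mem_chart1_inf.1 hz))).differentiableWithinAt)
  have hm : ∀ a w, (m a).1.2.1 w = ∑ i, a i * ((w : ℂ)⁻¹) ^ ((i : ℕ) + 1) := fun a w => by
    change ∑ i, a i * (w : ℂ) ^ (-(k : ℤ) - 1 - ((i : ℤ) - k)) = _
    refine Finset.sum_congr rfl fun i _ => ?_
    rw [show -(k : ℤ) - 1 - ((i : ℤ) - k) = -(((i : ℕ) + 1 : ℕ) : ℤ) by push_cast; ring, zpow_neg,
      zpow_natCast, inv_pow]
  let φ : (Fin k → ℂ) →ₗ[ℂ] (lineBundle (-(k : ℤ) - 1)).H1 0 := (Submodule.mkQ _).comp m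
  refine ⟨(LinearEquiv.ofBijective φ ⟨?_, ?_⟩).symm⟩
  · rw [← LinearMap.ker_eq_bot, LinearMap.ker_eq_bot']
    intro a ha
    have ha' : m a ∈ LinearMap.range ((lineBundle (-(k : ℤ) - 1)).cechD 0) :=
      (Submodule.Quotient.mk_eq_zero _).1 ha
    obtain ⟨⟨s, t⟩, hst⟩ := ha'
    obtain ⟨f, hf, hf'⟩ := exists_entire_fst s
    obtain ⟨g, hg, hg'⟩ := exists_entire_snd t
    have h0 : ∀ w : ℂ, w ≠ 0 → g w = ((∑ i, a i * w⁻¹ ^ (i : ℕ)) + w⁻¹ ^ k * f w⁻¹) * w⁻¹ := by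
      intro w hw
      have h1 := congrArg (fun r => r.1.2.1 ⟨w, mem_chart1_inf.2 hw⟩) hst
      have h2 : t.1.2.1 ⟨w, mem_chart1_U1 w⟩ - s.1.2.1 ⟨w, mem_chart1_U0.2 hw⟩ =
        (m a).1.2.1 ⟨w, mem_chart1_inf.2 hw⟩ := h1
      rw [hm, hg', lineBundle_snd s _ hw, hf', sub_eq_iff_eq_add] at h2
      rw [h2, add_mul, Finset.sum_mul, zpow_sub₀ hw, zpow_neg, zpow_natCast, zpow_one]
      congr 1
      · exact Finset.sum_congr rfl fun i _ => by ring
      · rw [inv_pow]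
        ring
    have h1 := (eq_zero_of_entire_eq_inv hg (f := fun z => (∑ i, a i * z ^ (i : ℕ)) + z ^ k * f z)
      ((by fun_prop : Continuous fun z : ℂ => ∑ i, a i * z ^ (i : ℕ)).add
        ((continuous_pow k).mul hf.continuous)) h0).2
    exact eq_zero_of_sum_eq_pow_mul (f := fun z => -f z) hf.continuous.neg fun z => by
      have := congrFun h1 z
      simp only [Pi.zero_apply] at this
      linear_combination this
  · intro s
    obtain ⟨s, rfl⟩ := Submodule.mkQ_surjective _ s
    obtain ⟨F, hF, hF'⟩ := exists_punctured_snd s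
    obtain ⟨g, u, hg, hu, H⟩ := exists_entire_add_entire_inv hF
    -- The constant term `b 0` is absorbed by the section over `U₁` and the remainder by the one
    -- over `U₀`; the `k` coefficients in between are the coordinates of the class.
    obtain ⟨b, f, hf, Hf⟩ := exists_eq_sum_add_pow_mul hu (k + 1)
    refine ⟨fun i => b i.succ, Eq.symm ((Submodule.Quotient.eq _).2
      ⟨(lineBundleMk0 _ (fun z => -f z) hf.neg, lineBundleMk1 _ (fun w => g w + b 0)
        (hg.add_const _)), lineBundle_ext_of_snd inf_le_right fun w => ?_⟩)⟩
    have hw : (w : ℂ) ≠ 0 := mem_chart1_inf.1 w.2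
    change g w + b 0 - -f (w : ℂ)⁻¹ * (w : ℂ) ^ (-(k : ℤ) - 1) = s.1.2.1 w - (m _).1.2.1 w
    rw [hF', H w hw, Hf, hm, Fin.sum_univ_succ, zpow_sub₀ hw, zpow_neg, zpow_natCast, zpow_one,
      inv_pow]
    simp only [Fin.val_zero, pow_zero, Fin.val_succ, inv_pow]
    field_simp
    ring

theorem lineBundle_obj_one_subsingleton (n : ℤ) (V : Opens P1) :
    Subsingleton ((lineBundle n).obj V 1) :=
  subsingleton_of_forall_eq 0 fun s => Subtype.ext (s.2.2 rfl)

/-! ## Isomorphisms of the parts of given parity, and their cohomology -/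

namespace SuperMod

/-- An isomorphism of the part of parity `p` of `F` with the part of parity `q` of `G`. -/
structure PartIso (F : SuperMod) (p : ZMod 2) (G : SuperMod) (q : ZMod 2) where
  equiv : ∀ V, F.obj V p ≃ₗ[OP1 V] G.obj V q
  naturality : ∀ {U V : Opens P1} (h : U ≤ V) (s : F.obj V p),
    equiv U (F.res h p s) = G.res h q (equiv V s)

namespace PartIso

variable {F G H K : SuperMod} {p q r : ZMod 2}

/-- The inverse isomorphism. -/
noncomputable def symm (e : PartIso F p G q) : PartIso G q F p where
  equiv V := (e.equiv V).symm
  naturality {U V} h s := by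
    rw [LinearEquiv.symm_apply_eq, e.naturality h, LinearEquiv.apply_symm_apply]

/-- Composition of isomorphisms. -/
noncomputable def trans (e : PartIso F p G q) (e' : PartIso G q H r) : PartIso F p H r where
  equiv V := (e.equiv V).trans (e'.equiv V)
  naturality h s := by
    rw [LinearEquiv.trans_apply, e.naturality h, e'.naturality h, LinearEquiv.trans_apply]

/-- The part of parity `p` of `Π F` is the part of parity `p + 1` of `F`. -/
noncomputable def ofPi (F : SuperMod) (h : p + 1 = q) : PartIso F.Pi p F q := by
  subst h
  exact ⟨fun V => LinearEquiv.refl (OP1 V) (F.obj V (p + 1)), fun _ _ => rfl⟩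

/-- A direct sum whose second summand vanishes. -/
noncomputable def sumOfSubsingletonRight (F G : SuperMod) (h : ∀ V, Subsingleton (G.obj V p)) :
    PartIso F p (F.sum G) p where
  equiv V :=
    { LinearMap.inl (OP1 V) (F.obj V p) (G.obj V p) with
      invFun := fun s => s.1
      left_inv := fun _ => rfl
      right_inv := fun _ => Prod.ext rfl ((h V).elim _ _) }
  naturality {U _} _ _ := Prod.ext rfl ((h U).elim _ _)

/-- A direct sum whose first summand vanishes. -/
noncomputable def sumOfSubsingletonLeft (F G : SuperMod) (h : ∀ V, Subsingleton (F.obj V p)) :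
    PartIso G p (F.sum G) p where
  equiv V :=
    { LinearMap.inr (OP1 V) (F.obj V p) (G.obj V p) with
      invFun := fun s => s.2
      left_inv := fun _ => rfl
      right_inv := fun _ => Prod.ext ((h V).elim _ _) rfl }
  naturality {U _} _ _ := Prod.ext ((h U).elim _ _) rfl

theorem equiv_cechD (e : PartIso F p G q) (s : F.obj U0 p × F.obj U1 p) :
    e.equiv _ (F.cechD p s) = G.cechD q (e.equiv _ s.1, e.equiv _ s.2) := by
  change e.equiv _ (F.res inf_le_right p s.2 - F.res inf_le_left p s.1) = _
  rw [map_sub, e.naturality, e.naturality]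
  rfl

/-- The isomorphism induced on `H⁰`. -/
noncomputable def h0Equiv (e : PartIso F p G q) : F.H0 p ≃ₗ[ℂ] G.H0 q :=
  LinearEquiv.ofSubmodules
    (((e.equiv U0).restrictScalars ℂ).prodCongr ((e.equiv U1).restrictScalars ℂ)) _ _ (by
      ext t
      rw [Submodule.mem_map_equiv, LinearMap.mem_ker, LinearMap.mem_ker]
      obtain ⟨s, rfl⟩ := (((e.equiv U0).restrictScalars ℂ).prodCongr
        ((e.equiv U1).restrictScalars ℂ)).surjective t
      rw [LinearEquiv.symm_apply_apply, ← (e.equiv (U0 ⊓ U1)).map_eq_zero_iff, equiv_cechD]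
      rfl)

/-- The isomorphism induced on `H¹`. -/
noncomputable def h1Equiv (e : PartIso F p G q) : F.H1 p ≃ₗ[ℂ] G.H1 q :=
  Submodule.Quotient.equiv _ _ ((e.equiv (U0 ⊓ U1)).restrictScalars ℂ) (by
    ext t
    constructor
    · rintro ⟨_, ⟨s, rfl⟩, rfl⟩
      exact ⟨_, (equiv_cechD e s).symm⟩
    · rintro ⟨s, rfl⟩
      refine ⟨_, ⟨((e.equiv U0).symm s.1, (e.equiv U1).symm s.2), rfl⟩, ?_⟩
      refine (equiv_cechD e _).trans ?_
      rw [LinearEquiv.apply_symm_apply, LinearEquiv.apply_symm_apply])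

end PartIso

theorem nonempty_iso_of_partIso {F G : SuperMod} (h : ∀ p, Nonempty (PartIso F p G p)) :
    Nonempty (Iso F G) :=
  ⟨⟨fun V p => (h p).some.equiv V, fun h' p s => (h p).some.naturality h' s⟩⟩

/-- The part of parity `p` has cohomology of dimensions `a` and `b`. -/
def HasCohomology (F : SuperMod) (p : ZMod 2) (a b : ℕ) : Prop :=
  Nonempty (F.H0 p ≃ₗ[ℂ] (Fin a → ℂ)) ∧ Nonempty (F.H1 p ≃ₗ[ℂ] (Fin b → ℂ))

theorem HasCohomology.congr {F G : SuperMod} {p q : ZMod 2} {a b : ℕ} (h : G.HasCohomology q a b)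
    (e : PartIso F p G q) : F.HasCohomology p a b :=
  ⟨h.1.map e.h0Equiv.trans, h.2.map e.h1Equiv.trans⟩

/-- `ℂ^a ⊕ ℂ^b ≃ ℂ^(a+b)`. -/
noncomputable def finProdEquiv (a b : ℕ) : ((Fin a → ℂ) × (Fin b → ℂ)) ≃ₗ[ℂ] (Fin (a + b) → ℂ) :=
  (LinearEquiv.sumArrowLequivProdArrow (Fin a) (Fin b) ℂ ℂ).symm.trans
    (LinearEquiv.funCongrLeft ℂ ℂ finSumFinEquiv.symm)

/-- `H⁰` of a direct sum. -/
noncomputable def h0SumEquiv (F G : SuperMod) (p : ZMod 2) :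
    (F.sum G).H0 p ≃ₗ[ℂ] F.H0 p × G.H0 p where
  toFun s := (⟨(s.1.1.1, s.1.2.1), congrArg Prod.fst s.2⟩, ⟨(s.1.1.2, s.1.2.2), congrArg Prod.snd s.2⟩)
  invFun t := ⟨((t.1.1.1, t.2.1.1), (t.1.1.2, t.2.1.2)), Prod.ext t.1.2 t.2.2⟩
  map_add' _ _ := rfl
  map_smul' _ _ := rfl
  left_inv _ := rfl
  right_inv _ := rfl

/-- `H¹` of a direct sum. -/
noncomputable def h1SumEquiv (F G : SuperMod) (p : ZMod 2) :
    (F.sum G).H1 p ≃ₗ[ℂ] F.H1 p × G.H1 p :=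
  let f : (F.sum G).obj (U0 ⊓ U1) p →ₗ[ℂ] F.H1 p × G.H1 p :=
    (Submodule.mkQ (LinearMap.range (F.cechD p))).prodMap
      (Submodule.mkQ (LinearMap.range (G.cechD p)))
  have hf : LinearMap.range ((F.sum G).cechD p) = LinearMap.ker f := by
    have hk : LinearMap.ker f =
        (LinearMap.range (F.cechD p)).prod (LinearMap.range (G.cechD p)) :=
      (LinearMap.ker_prodMap _ _).trans (by rw [Submodule.ker_mkQ, Submodule.ker_mkQ])
    rw [hk]
    ext t
    constructor
    · rintro ⟨s, rfl⟩
      exact ⟨⟨(s.1.1, s.2.1), rfl⟩, ⟨(s.1.2, s.2.2), rfl⟩⟩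
    · rintro ⟨⟨s, hs⟩, ⟨s', hs'⟩⟩
      exact ⟨((s.1, s'.1), (s.2, s'.2)), Prod.ext hs hs'⟩
  (Submodule.quotEquivOfEq _ _ hf).trans (f.quotKerEquivOfSurjective
    ((Submodule.mkQ_surjective _).prodMap (Submodule.mkQ_surjective _)))

theorem HasCohomology.sum {F G : SuperMod} {p : ZMod 2} {a b a' b' : ℕ}
    (hF : F.HasCohomology p a b) (hG : G.HasCohomology p a' b') :
    (F.sum G).HasCohomology p (a + a') (b + b') := by
  obtain ⟨⟨f⟩, ⟨f'⟩⟩ := hF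
  obtain ⟨⟨g⟩, ⟨g'⟩⟩ := hG
  exact ⟨⟨(h0SumEquiv F G p).trans ((f.prodCongr g).trans (finProdEquiv _ _))⟩,
    ⟨(h1SumEquiv F G p).trans ((f'.prodCongr g').trans (finProdEquiv _ _))⟩⟩

theorem HasCohomology.isSuperC {F : SuperMod} {a b c d : ℕ} (h0 : F.HasCohomology 0 a b)
    (h1 : F.HasCohomology 1 c d) : IsSuperC F.H0 a c ∧ IsSuperC F.H1 b d :=
  ⟨⟨h0.1, h1.1⟩, ⟨h0.2, h1.2⟩⟩

/-- The direct sum of copies of `F` indexed by `J`. -/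
noncomputable def copies (F : SuperMod) (J : Type) : SuperMod where
  obj V p := J → F.obj V p
  res h p := (F.res h p).compLeft J
  res_smul h p f s := funext fun j => F.res_smul h p f (s j)
  res_refl V p s := funext fun j => F.res_refl V p (s j)
  res_trans h h' p s := funext fun j => F.res_trans h h' p (s j)

/-- A single copy. -/
noncomputable def copiesUnit (F : SuperMod) (p : ZMod 2) : PartIso (F.copies Unit) p F p where
  equiv V := LinearEquiv.funUnique Unit (OP1 V) (F.obj V p)
  naturality _ _ := rfl

/-- Two copies. -/
noncomputable def copiesTwo (F : SuperMod) (p : ZMod 2) {J : Type} (e : J ≃ Fin 2) :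
    PartIso (F.copies J) p (F.sum F) p where
  equiv V := (LinearEquiv.funCongrLeft (OP1 V) (F.obj V p) e.symm).trans
    (LinearEquiv.finTwoArrow (OP1 V) (F.obj V p))
  naturality _ _ := rfl

end SuperMod

theorem lineBundle_hasCohomology_of_nonneg (N : ℕ) :
    (lineBundle (N : ℤ)).HasCohomology 0 (N + 1) 0 :=
  ⟨lineBundle_H0_of_nonneg N, lineBundle_H1_of_nonneg N⟩

theorem lineBundle_hasCohomology_of_neg (k : ℕ) :
    (lineBundle (-(k : ℤ) - 1)).HasCohomology 0 0 k :=
  ⟨lineBundle_H0_of_neg k, lineBundle_H1_of_neg k⟩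

/-! ## Reduction of locally free sheaves on `ℙ^{1|1}` to the projective line -/

theorem zmod_two_cases (q : ZMod 2) : q = 0 ∨ q = 1 := by
  revert q
  decide

namespace SFun

variable {W W' : Opens ℂ}

/-- The component of parity `q` of a superfunction. -/
noncomputable def comp (q : ZMod 2) (s : SFun W) : Hol W := if q = 0 then s.fst else s.snd

/-- The superfunction of parity `q` with a given component. -/
noncomputable def emb (q : ZMod 2) (a : Hol W) : SFun W :=
  if q = 0 then TrivSqZeroExt.inl a else TrivSqZeroExt.inr a

theorem comp_zero (s : SFun W) : comp 0 s = s.fst := rfl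

theorem comp_one (s : SFun W) : comp 1 s = s.snd := rfl

theorem emb_zero (a : Hol W) : emb 0 a = TrivSqZeroExt.inl a := rfl

theorem emb_one (a : Hol W) : emb 1 a = TrivSqZeroExt.inr a := rfl

theorem hasParity_zero_iff {s : SFun W} : s.HasParity 0 ↔ s.snd = 0 :=
  ⟨fun h => h.1 rfl, fun h => ⟨fun _ => h, fun h0 => absurd h0 zero_ne_one⟩⟩

theorem hasParity_one_iff {s : SFun W} : s.HasParity 1 ↔ s.fst = 0 :=
  ⟨fun h => h.2 rfl, fun h => ⟨fun h0 => absurd h0.symm zero_ne_one, fun _ => h⟩⟩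

theorem hasParity_inl (a : Hol W) : HasParity 0 (TrivSqZeroExt.inl a : SFun W) :=
  hasParity_zero_iff.2 rfl

theorem hasParity_inr (a : Hol W) : HasParity 1 (TrivSqZeroExt.inr a : SFun W) :=
  hasParity_one_iff.2 rfl

theorem hasParity_zero_self (q : ZMod 2) : (0 : SFun W).HasParity q :=
  ⟨fun _ => rfl, fun _ => rfl⟩

theorem hasParity_emb (q : ZMod 2) (a : Hol W) : (emb q a).HasParity q := by
  rcases zmod_two_cases q with rfl | rfl
  · exact hasParity_inl a
  · exact hasParity_inr a

theorem comp_emb (q : ZMod 2) (a : Hol W) : comp q (emb q a) = a := by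
  rcases zmod_two_cases q with rfl | rfl <;> rfl

theorem emb_comp {q : ZMod 2} {s : SFun W} (h : s.HasParity q) : emb q (comp q s) = s := by
  rcases zmod_two_cases q with rfl | rfl
  · exact TrivSqZeroExt.ext rfl (hasParity_zero_iff.1 h).symm
  · exact TrivSqZeroExt.ext (hasParity_one_iff.1 h).symm rfl

theorem HasParity.ext {q : ZMod 2} {s t : SFun W} (hs : s.HasParity q) (ht : t.HasParity q)
    (h : comp q s = comp q t) : s = t := by
  rw [← emb_comp hs, ← emb_comp ht, h]

theorem HasParity.mul {q q' : ZMod 2} {s t : SFun W} (hs : s.HasParity q) (ht : t.HasParity q') :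
    (s * t).HasParity (q + q') := by
  rw [← emb_comp hs, ← emb_comp ht]
  rcases zmod_two_cases q with rfl | rfl <;> rcases zmod_two_cases q' with rfl | rfl <;>
    simp only [emb_zero, emb_one]
  · rw [← TrivSqZeroExt.inl_mul]
    exact hasParity_inl _
  · rw [TrivSqZeroExt.inl_mul_inr]
    exact hasParity_inr _
  · rw [TrivSqZeroExt.inr_mul_inl]
    exact hasParity_inr _
  · rw [TrivSqZeroExt.inr_mul_inr]
    exact hasParity_zero_self _

theorem HasParity.sum {ι : Type} [Fintype ι] {q : ZMod 2} {s : ι → SFun W}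
    (h : ∀ i, (s i).HasParity q) : (∑ i, s i).HasParity q := by
  rcases zmod_two_cases q with rfl | rfl
  · rw [hasParity_zero_iff, TrivSqZeroExt.snd_sum]
    exact Finset.sum_eq_zero fun i _ => hasParity_zero_iff.1 (h i)
  · rw [hasParity_one_iff, TrivSqZeroExt.fst_sum]
    exact Finset.sum_eq_zero fun i _ => hasParity_one_iff.1 (h i)

theorem comp_sum {ι : Type} [Fintype ι] (q : ZMod 2) (s : ι → SFun W) :
    comp q (∑ i, s i) = ∑ i, comp q (s i) := by
  rcases zmod_two_cases q with rfl | rfl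
  · exact TrivSqZeroExt.fst_sum _ _
  · exact TrivSqZeroExt.snd_sum _ _

theorem comp_inl_mul (q : ZMod 2) (a : Hol W) (s : SFun W) :
    comp q (TrivSqZeroExt.inl a * s) = a * comp q s := by
  rcases zmod_two_cases q with rfl | rfl
  · simp [comp_zero]
  · simp [comp_one]

theorem res_emb (h : W' ≤ W) (q : ZMod 2) (a : Hol W) :
    SFun.res h (emb q a) = emb q (Hol.res h a) := by
  rcases zmod_two_cases q with rfl | rfl
  · ext1 <;> simp [SFun.res, SFun.pull, emb_zero]
  · ext1 <;> simp [SFun.res, SFun.pull, emb_one]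

theorem comp_res (h : W' ≤ W) (q : ZMod 2) (s : SFun W) :
    comp q (SFun.res h s) = Hol.res h (comp q s) := by
  rcases zmod_two_cases q with rfl | rfl
  · simp [SFun.res, SFun.pull, comp_zero]
  · simp [SFun.res, SFun.pull, comp_one]

theorem HasParity.res (h : W' ≤ W) {q : ZMod 2} {s : SFun W} (hs : s.HasParity q) :
    (SFun.res h s).HasParity q := by
  rw [← emb_comp hs, res_emb]
  exact hasParity_emb _ _

/-- The factor `1` or `θ₀ = w⁻¹ θ₁` by which a coefficient of parity `q` is transformed. -/
noncomputable def frameCoeff (q : ZMod 2) : SFun Cstar := emb q (if q = 0 then 1 else invFn)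

theorem hasParity_frameCoeff (q : ZMod 2) : (frameCoeff q).HasParity q := hasParity_emb _ _

/-- This isolates the odd coordinate change in one factor: the coefficient then enters as a plain
holomorphic function, and a matrix over `Hol Cstar` can be read off. -/
theorem toOverlap_emb (V : Opens P1) (q : ZMod 2) (a : Hol (chart0 V)) :
    SFun.toOverlap V (emb q a) =
      TrivSqZeroExt.inl (Hol.toOverlap V a) * SFun.res (overlap_le_Cstar V) (frameCoeff q) := by
  rcases zmod_two_cases q with rfl | rfl
  · rw [frameCoeff, if_pos rfl, res_emb, map_one]
    ext1 <;> simp [SFun.toOverlap, SFun.pull, emb_zero]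
  · rw [frameCoeff, if_neg one_ne_zero, res_emb]
    ext1 <;> simp [SFun.toOverlap, SFun.pull, emb_one, mul_comm]

theorem comp_smul0 {V : Opens P1} (q : ZMod 2) (f : OP1 V) (s : SFun (chart0 V)) :
    comp q (f • s) = f • comp q s := by
  rcases zmod_two_cases q with rfl | rfl <;> rfl

theorem comp_smul1 {V : Opens P1} (q : ZMod 2) (f : OP1 V) (s : SFun (chart1 V)) :
    comp q (f • s) = f • comp q s := by
  rcases zmod_two_cases q with rfl | rfl <;> rfl

theorem comp_add (q : ZMod 2) (s t : SFun W) : comp q (s + t) = comp q s + comp q t := by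
  rcases zmod_two_cases q with rfl | rfl <;> rfl

end SFun

/-- An entire function of `z`, on an open subset of `U₀`. -/
noncomputable def Hol.ofEntire (W : Opens ℂ) : Hol ⊤ →ₐ[ℂ] Hol W := Hol.res le_top

/-- An entire function of `z = 1/w`, on the punctured plane. -/
noncomputable def Hol.ofEntireInv : Hol ⊤ →ₐ[ℂ] Hol Cstar :=
  Hol.pull (fun w => w⁻¹)
    (fun _ hw => (differentiableAt_inv hw).differentiableWithinAt) (fun _ _ => trivial)

theorem mem_lineSections_zero_iff {n : ℤ} {V : Opens P1} {s : Hol (chart0 V) × Hol (chart1 V)} :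
    s ∈ lineSections n V 0 ↔ Hol.res (overlap_le_chart1 V) s.2 =
      Hol.toOverlap V s.1 * Hol.res (overlap_le_Cstar V) ((wUnit ^ n : (Hol Cstar)ˣ) : Hol Cstar) :=
  ⟨fun h => h.1, fun h => ⟨h, fun h0 => absurd h0 zero_ne_one⟩⟩

namespace LocFree

open SFun

variable {ι : Type} [Fintype ι]

/-- The transition matrix of the part of parity `p` of a locally free sheaf over the structure sheaf of
the projective line. -/
noncomputable def red (E : LocFree ι) (p : ZMod 2) : Matrix ι ι (Hol Cstar) :=
  Matrix.of fun i j => comp (p + E.par j) (frameCoeff (p + E.par i) * E.M i j)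

/-- As the transition matrix preserves parity, both sides of the gluing equation at `j` have parity
`p + E.par j`. Such superfunctions have a single component, so nothing is lost by comparing
components. -/
theorem mem_sections_iff (E : LocFree ι) (p : ZMod 2) (V : Opens P1)
    (hM : ∀ i j, (E.M i j).HasParity (E.par i + E.par j))
    (a : ι → Hol (chart0 V)) (b : ι → Hol (chart1 V)) :
    ((fun i => emb (p + E.par i) (a i), fun i => emb (p + E.par i) (b i)) :
        (ι → SFun (chart0 V)) × (ι → SFun (chart1 V))) ∈ E.sections V p ↔
      Hol.res (overlap_le_chart1 V) ∘ b = Matrix.vecMul (Hol.toOverlap V ∘ a)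
        ((E.red p).map (Hol.res (overlap_le_Cstar V))) := by
  have hterm : ∀ i j, SFun.toOverlap V (emb (p + E.par i) (a i)) *
      SFun.res (overlap_le_Cstar V) (E.M i j) = TrivSqZeroExt.inl (Hol.toOverlap V (a i)) *
        SFun.res (overlap_le_Cstar V) (frameCoeff (p + E.par i) * E.M i j) := fun i j => by
    rw [toOverlap_emb, map_mul, mul_assoc]
  have hpar : ∀ j, (∑ i, SFun.toOverlap V (emb (p + E.par i) (a i)) *
      SFun.res (overlap_le_Cstar V) (E.M i j)).HasParity (p + E.par j) := fun j => by
    refine HasParity.sum fun i => ?_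
    rw [hterm]
    have h1 := (hasParity_inl (Hol.toOverlap V (a i))).mul
      (((hasParity_frameCoeff (p + E.par i)).mul (hM i j)).res (overlap_le_Cstar V))
    -- The parity of the generator `i` occurs twice and cancels.
    have h2 : ∀ x y z : ZMod 2, 0 + (x + y + (y + z)) = x + z := by decide
    rw [h2] at h1
    exact h1
  have hcomp : ∀ j, comp (p + E.par j) (∑ i, SFun.toOverlap V (emb (p + E.par i) (a i)) *
      SFun.res (overlap_le_Cstar V) (E.M i j)) = Matrix.vecMul (Hol.toOverlap V ∘ a)
        ((E.red p).map (Hol.res (overlap_le_Cstar V))) j := fun j => by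
    rw [comp_sum]
    refine Finset.sum_congr rfl fun i _ => ?_
    rw [hterm, comp_inl_mul, comp_res]
    rfl
  constructor
  · rintro ⟨-, -, h⟩
    funext j
    have h1 := congrArg (comp (p + E.par j)) (h j)
    rw [hcomp, comp_res, comp_emb] at h1
    exact h1
  · intro h
    refine ⟨fun i => hasParity_emb _ _, fun i => hasParity_emb _ _, fun j => ?_⟩
    refine HasParity.ext ((hasParity_emb _ _).res _) (hpar j) ?_
    rw [hcomp, comp_res, comp_emb, ← h]
    rfl

theorem comp_section (E : LocFree ι) (p : ZMod 2) (V : Opens P1)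
    (hM : ∀ i j, (E.M i j).HasParity (E.par i + E.par j))
    {s : (ι → SFun (chart0 V)) × (ι → SFun (chart1 V))} (hs : s ∈ E.sections V p) :
    (Hol.res (overlap_le_chart1 V) ∘ fun i => comp (p + E.par i) (s.2 i)) =
      Matrix.vecMul (Hol.toOverlap V ∘ fun i => comp (p + E.par i) (s.1 i))
        ((E.red p).map (Hol.res (overlap_le_Cstar V))) := by
  rw [← E.mem_sections_iff p V hM]
  simp only [emb_comp (hs.1 _), emb_comp (hs.2.1 _)]
  exact hs

/-- With `b = aN` the new coordinates satisfy `bQ = aNQ = wⁿ aP`. Since `P` is entire in `z` and `Q`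
is entire in `w`, they act as changes of frame over `U₀` and `U₁`. -/
theorem vecMul_mem_lineSections {n : ℤ} {V : Opens P1} {N : Matrix ι ι (Hol Cstar)}
    {P Q : Matrix ι ι (Hol ⊤)}
    (key : N * Q.map (Hol.ofEntire Cstar) =
      ((wUnit ^ n : (Hol Cstar)ˣ) : Hol Cstar) • P.map Hol.ofEntireInv)
    {a : ι → Hol (chart0 V)} {b : ι → Hol (chart1 V)}
    (h : Hol.res (overlap_le_chart1 V) ∘ b = Matrix.vecMul (Hol.toOverlap V ∘ a)
        (N.map (Hol.res (overlap_le_Cstar V)))) (j : ι) :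
    (Matrix.vecMul a (P.map (Hol.ofEntire _)) j, Matrix.vecMul b (Q.map (Hol.ofEntire _)) j) ∈
      lineSections n V 0 := by
  rw [mem_lineSections_zero_iff]
  have h1 : Hol.res (overlap_le_chart1 V) (Matrix.vecMul b (Q.map (Hol.ofEntire _)) j) =
      Matrix.vecMul (Hol.res (overlap_le_chart1 V) ∘ b)
        ((Q.map (Hol.ofEntire Cstar)).map (Hol.res (overlap_le_Cstar V))) j :=
    (RingHom.map_vecMul (Hol.res (overlap_le_chart1 V)).toRingHom _ _ j)
  have h2 : Hol.toOverlap V (Matrix.vecMul a (P.map (Hol.ofEntire _)) j) =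
      Matrix.vecMul (Hol.toOverlap V ∘ a)
        ((P.map Hol.ofEntireInv).map (Hol.res (overlap_le_Cstar V))) j :=
    (RingHom.map_vecMul (Hol.toOverlap V).toRingHom _ _ j)
  have h3 := congrArg (fun X => X.map (Hol.res (overlap_le_Cstar V))) key
  simp only [Matrix.map_mul] at h3
  change Hol.res _ (Matrix.vecMul b (Q.map (Hol.ofEntire _)) j) = _
  rw [h1, h, Matrix.vecMul_vecMul, h3, h2, mul_comm]
  rw [Matrix.map_smul' _ _ _ (map_mul _), Matrix.vecMul_smul]
  rfl

/-- For the way back: `P` and `Q` here play the role of the inverses of the matrices in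
`vecMul_mem_lineSections`. -/
theorem vecMul_mem_sections {n : ℤ} {V : Opens P1} {N : Matrix ι ι (Hol Cstar)}
    {P Q : Matrix ι ι (Hol ⊤)}
    (key : P.map Hol.ofEntireInv * N =
      ((wUnit ^ n : (Hol Cstar)ˣ) : Hol Cstar) • Q.map (Hol.ofEntire Cstar))
    {t : ι → Hol (chart0 V) × Hol (chart1 V)} (ht : ∀ j, t j ∈ lineSections n V 0) :
    Hol.res (overlap_le_chart1 V) ∘ Matrix.vecMul (fun j => (t j).2) (Q.map (Hol.ofEntire _)) =
      Matrix.vecMul (Hol.toOverlap V ∘ Matrix.vecMul (fun j => (t j).1) (P.map (Hol.ofEntire _)))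
        (N.map (Hol.res (overlap_le_Cstar V))) := by
  have h1 : Hol.res (overlap_le_chart1 V) ∘
      Matrix.vecMul (fun j => (t j).2) (Q.map (Hol.ofEntire _)) =
      Matrix.vecMul (Hol.res (overlap_le_chart1 V) ∘ fun j => (t j).2)
        ((Q.map (Hol.ofEntire Cstar)).map (Hol.res (overlap_le_Cstar V))) := funext fun j =>
    (RingHom.map_vecMul (Hol.res (overlap_le_chart1 V)).toRingHom _ _ j)
  have h2 : Hol.toOverlap V ∘ Matrix.vecMul (fun j => (t j).1) (P.map (Hol.ofEntire _)) =
      Matrix.vecMul (Hol.toOverlap V ∘ fun j => (t j).1)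
        ((P.map Hol.ofEntireInv).map (Hol.res (overlap_le_Cstar V))) := funext fun j =>
    (RingHom.map_vecMul (Hol.toOverlap V).toRingHom _ _ j)
  have h3 := congrArg (fun X => X.map (Hol.res (overlap_le_Cstar V))) key
  simp only [Matrix.map_mul] at h3
  have h4 : (Hol.res (overlap_le_chart1 V) ∘ fun j => (t j).2) =
      Hol.res (overlap_le_Cstar V) ((wUnit ^ n : (Hol Cstar)ˣ) : Hol Cstar) •
        (Hol.toOverlap V ∘ fun j => (t j).1) := funext fun j => by
    refine (mem_lineSections_zero_iff.1 (ht j)).trans ?_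
    rw [mul_comm]
    rfl
  rw [h1, h2, Matrix.vecMul_vecMul, h3, Matrix.map_smul' _ _ _ (map_mul _), Matrix.vecMul_smul, h4,
    Matrix.smul_vecMul]

variable [DecidableEq ι]

/-- The part of parity `p` of a locally free sheaf is a sum of copies of a line bundle if its transition
matrix is `wⁿ` after changes of the frames over `U₀` and over `U₁`. -/
noncomputable def partIsoCopies (E : LocFree ι) (p : ZMod 2) (n : ℤ)
    (hM : ∀ i j, (E.M i j).HasParity (E.par i + E.par j)) (P P' Q Q' : Matrix ι ι (Hol ⊤))
    (hP : P * P' = 1) (hQ : Q * Q' = 1)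
    (key : E.red p * Q.map (Hol.ofEntire Cstar) =
      ((wUnit ^ n : (Hol Cstar)ˣ) : Hol Cstar) • P.map Hol.ofEntireInv) :
    SuperMod.PartIso E.sheaf p ((lineBundle n).copies ι) 0 :=
  have hP' : P' * P = 1 := mul_eq_one_comm.1 hP
  have hQ' : Q' * Q = 1 := mul_eq_one_comm.1 hQ
  have map_one : ∀ {R S : Type} [CommRing R] [CommRing S] [Algebra ℂ R] [Algebra ℂ S]
      (f : R →ₐ[ℂ] S) {A B : Matrix ι ι R}, A * B = 1 → A.map f * B.map f = 1 :=
    fun f A B h => by rw [← Matrix.map_mul, h, Matrix.map_one _ (map_zero f) (map_one f)]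
  -- Obtained from `key` by multiplying with `P'` on the left and `Q'` on the right.
  have key' : P'.map Hol.ofEntireInv * E.red p =
      ((wUnit ^ n : (Hol Cstar)ˣ) : Hol Cstar) • Q'.map (Hol.ofEntire Cstar) := by
    have h1 := congrArg (fun X => P'.map Hol.ofEntireInv * X * Q'.map (Hol.ofEntire Cstar)) key
    simp only [mul_assoc, map_one _ hQ, mul_one, Matrix.smul_mul, Matrix.mul_smul] at h1
    rw [h1, ← mul_assoc, map_one _ hP', one_mul]
  { equiv := fun V =>
      { toFun := fun s j => ⟨(Matrix.vecMul (fun i => comp (p + E.par i) (s.1.1 i))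
            (P.map (Hol.ofEntire _)) j, Matrix.vecMul (fun i => comp (p + E.par i) (s.1.2 i))
            (Q.map (Hol.ofEntire _)) j), vecMul_mem_lineSections key (E.comp_section p V hM s.2) j⟩
        map_add' := fun s t => by
          funext j
          refine Subtype.ext (Prod.ext ?_ ?_)
          · refine Eq.trans ?_ (congrFun (Matrix.add_vecMul _ _ _) j)
            exact congrArg (fun v => Matrix.vecMul v _ j) (funext fun i => comp_add _ _ _)
          · refine Eq.trans ?_ (congrFun (Matrix.add_vecMul _ _ _) j)
            exact congrArg (fun v => Matrix.vecMul v _ j) (funext fun i => comp_add _ _ _)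
        map_smul' := fun f s => by
          funext j
          refine Subtype.ext (Prod.ext ?_ ?_)
          · refine Eq.trans ?_ (congrFun (Matrix.smul_vecMul (OP1.in0 V f) _ _) j)
            exact congrArg (fun v => Matrix.vecMul v _ j) (funext fun i => comp_smul0 _ _ _)
          · refine Eq.trans ?_ (congrFun (Matrix.smul_vecMul (OP1.in1 V f) _ _) j)
            exact congrArg (fun v => Matrix.vecMul v _ j) (funext fun i => comp_smul1 _ _ _)
        invFun := fun t => ⟨_, (E.mem_sections_iff p V hM _ _).2
          (vecMul_mem_sections key' fun j => (t j).2)⟩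
        left_inv := fun s => by
          refine Subtype.ext (Prod.ext (funext fun i => ?_) (funext fun i => ?_))
          · refine Eq.trans (congrArg (emb _) ?_) (emb_comp (s.2.1 i))
            refine (congrFun (Matrix.vecMul_vecMul _ _ _) i).trans ?_
            rw [map_one _ hP, Matrix.vecMul_one]
          · refine Eq.trans (congrArg (emb _) ?_) (emb_comp (s.2.2.1 i))
            refine (congrFun (Matrix.vecMul_vecMul _ _ _) i).trans ?_
            rw [map_one _ hQ, Matrix.vecMul_one]
        right_inv := fun t => by
          funext j
          refine Subtype.ext (Prod.ext ?_ ?_)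
          · refine (congrArg (fun v => Matrix.vecMul v _ j) (funext fun i => comp_emb _ _)).trans ?_
            refine (congrFun (Matrix.vecMul_vecMul _ _ _) j).trans ?_
            rw [map_one _ hP', Matrix.vecMul_one]
          · refine (congrArg (fun v => Matrix.vecMul v _ j) (funext fun i => comp_emb _ _)).trans ?_
            refine (congrFun (Matrix.vecMul_vecMul _ _ _) j).trans ?_
            rw [map_one _ hQ', Matrix.vecMul_one] }
    naturality := fun {U V} h s => by
      funext j
      refine Subtype.ext (Prod.ext ?_ ?_)
      · refine Eq.trans ?_ (RingHom.map_vecMul (Hol.res (chart0_mono h)).toRingHom _ _ j).symm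
        exact congrArg (fun v => Matrix.vecMul v _ j) (funext fun i => comp_res _ _ _)
      · refine Eq.trans ?_ (RingHom.map_vecMul (Hol.res (chart1_mono h)).toRingHom _ _ j).symm
        exact congrArg (fun v => Matrix.vecMul v _ j) (funext fun i => comp_res _ _ _) }

end LocFree

/-! ## The transition matrices -/

theorem idFn_mul_invFn : idFn * invFn = 1 := wUnit.val_inv

theorem deriv_zero_hol {W : Opens ℂ} : (0 : Hol W).deriv = 0 := Hol.ext fun z => by
  change deriv (Function.extend Subtype.val (0 : W → ℂ) 0) (z : ℂ) = 0
  rw [Function.extend_zero]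
  exact deriv_const (z : ℂ) 0

theorem deriv_invFn : invFn.deriv = -invFn ^ 2 := Hol.ext fun w => by
  have hw : (w : ℂ) ≠ 0 := w.2
  change deriv (Function.extend Subtype.val (fun x : Cstar => (x : ℂ)⁻¹) (0 : ℂ → ℂ)) (w : ℂ) =
    -((w : ℂ)⁻¹ ^ 2)
  rw [inv_pow, ← deriv_inv]
  refine Filter.EventuallyEq.deriv_eq ?_
  filter_upwards [Cstar.isOpen.mem_nhds w.2] with x hx
  exact Subtype.val_injective.extend_apply _ (0 : ℂ → ℂ) (⟨x, hx⟩ : Cstar)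

/-- The only off-diagonal entry is `∂θ₀/∂z₁ = -w⁻²θ₁`, as `z₀` does not involve `θ₁`. All later
matrices inherit this triangular form. -/
theorem cotangent_M : cotangent.M = !![TrivSqZeroExt.inl (-invFn ^ 2), 0;
    TrivSqZeroExt.inr (-invFn ^ 2), TrivSqZeroExt.inl invFn] := by
  ext i j : 1
  fin_cases i <;> fin_cases j <;>
    simp [cotangent, transCoord, SFun.partial, deriv_zero_hol, deriv_invFn]

theorem cotangent_M_inv : cotangent.M⁻¹ = !![TrivSqZeroExt.inl (-idFn ^ 2), 0;
    TrivSqZeroExt.inr (-idFn), TrivSqZeroExt.inl idFn] := by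
  have h := idFn_mul_invFn
  refine Matrix.inv_eq_right_inv ?_
  rw [cotangent_M]
  ext i j : 1
  fin_cases i <;> fin_cases j <;>
    simp [Matrix.mul_apply, Fin.sum_univ_two]
  · ext1 <;> simp
    linear_combination (idFn * invFn + 1) * h
  · ext1 <;> simp
    linear_combination (invFn * idFn) * h
  · ext1 <;> simp
    linear_combination h

/-- The sign of the supertranspose falls on the entry `(1, 0)`, which is zero. -/
theorem tangent_M : tangent.M = !![TrivSqZeroExt.inl (-idFn ^ 2), TrivSqZeroExt.inr (-idFn);
    0, TrivSqZeroExt.inl idFn] := by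
  ext i j : 1
  change (if cotangent.par i = 1 ∧ cotangent.par j = 0 then -1 else 1) * cotangent.M⁻¹ j i = _
  rw [cotangent_M_inv]
  fin_cases i <;> fin_cases j <;> simp [cotangent]

theorem cotangent_Pi_par (i : Fin 2) : cotangent.Pi.par i = if i = 0 then 1 else 0 := by
  fin_cases i <;> rfl

/-- Parity reversal makes `πdθ` even and `πdz` odd, so `A` is `M 1 1`, `D` is `M 0 0`, and `C`,
which is `M 0 1`, vanishes. The Berezinian is `w⁻¹ · (-w²)`. -/
theorem ber_cotangent_Pi_M : cotangent.Pi.ber.M = Matrix.of fun _ _ => TrivSqZeroExt.inl (-idFn) := by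
  have h := idFn_mul_invFn
  ext x y : 1
  have h0 : ∀ i, cotangent.Pi.par i = 0 → i = 1 := fun i hi => by
    rw [cotangent_Pi_par] at hi
    fin_cases i
    · exact absurd hi (by decide)
    · rfl
  have h1 : ∀ i, cotangent.Pi.par i = 1 → i = 0 := fun i hi => by
    rw [cotangent_Pi_par] at hi
    fin_cases i
    · rfl
    · exact absurd hi (by decide)
  let : Unique {i // cotangent.Pi.par i = 0} :=
    ⟨⟨⟨1, rfl⟩⟩, fun i => Subtype.ext (h0 i i.2)⟩
  let : Unique {i // cotangent.Pi.par i = 1} :=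
    ⟨⟨⟨0, rfl⟩⟩, fun i => Subtype.ext (h1 i i.2)⟩
  have hC : cotangent.Pi.M.toBlock (fun i => cotangent.Pi.par i = 1)
      (fun i => cotangent.Pi.par i = 0) = 0 := by
    ext i j : 1
    rw [Unique.eq_default i, Unique.eq_default j]
    change cotangent.M 0 1 = 0
    rw [cotangent_M]
    rfl
  change ((cotangent.Pi.M.toBlock (fun i => cotangent.Pi.par i = 0) (fun i => cotangent.Pi.par i = 0)
    - cotangent.Pi.M.toBlock (fun i => cotangent.Pi.par i = 0) (fun i => cotangent.Pi.par i = 1) *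
    (cotangent.Pi.M.toBlock (fun i => cotangent.Pi.par i = 1) (fun i => cotangent.Pi.par i = 1))⁻¹ *
    cotangent.Pi.M.toBlock (fun i => cotangent.Pi.par i = 1)
      (fun i => cotangent.Pi.par i = 0)).det * Ring.inverse (cotangent.Pi.M.toBlock
      (fun i => cotangent.Pi.par i = 1) (fun i => cotangent.Pi.par i = 1)).det) = _
  rw [hC, Matrix.mul_zero, sub_zero, Matrix.det_unique, Matrix.det_unique]
  change cotangent.M 1 1 * Ring.inverse (cotangent.M 0 0) = _
  rw [cotangent_M]
  have hinv : Ring.inverse (TrivSqZeroExt.inl (-invFn ^ 2) : SFun Cstar) =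
      TrivSqZeroExt.inl (-idFn ^ 2) := by
    have h2 : (TrivSqZeroExt.inl (-invFn ^ 2) : SFun Cstar) * TrivSqZeroExt.inl (-idFn ^ 2) = 1 := by
      rw [← TrivSqZeroExt.inl_mul, ← TrivSqZeroExt.inl_one]
      refine congrArg TrivSqZeroExt.inl ?_
      linear_combination (idFn * invFn + 1) * h
    exact Ring.inverse_unit ⟨_, _, h2, (mul_comm _ _).trans h2⟩
  change TrivSqZeroExt.inl invFn * Ring.inverse (TrivSqZeroExt.inl (-invFn ^ 2)) = _
  rw [hinv, ← TrivSqZeroExt.inl_mul]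
  refine congrArg TrivSqZeroExt.inl ?_
  linear_combination (-idFn) * h

theorem berP11_M : berP11.M = Matrix.of fun _ _ => TrivSqZeroExt.inl (-invFn) := by
  have h := idFn_mul_invFn
  have hinv : (cotangent.Pi.ber.M)⁻¹ = Matrix.of fun _ _ => TrivSqZeroExt.inl (-invFn) := by
    refine Matrix.inv_eq_right_inv ?_
    rw [ber_cotangent_Pi_M]
    ext i j : 1
    simp only [Matrix.mul_apply, Finset.univ_unique, Finset.sum_singleton, Matrix.of_apply]
    rw [← TrivSqZeroExt.inl_mul, neg_mul_neg, h, Subsingleton.elim i j, Matrix.one_apply_eq]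
    rfl
  ext i j : 1
  change (if cotangent.Pi.ber.par i = 1 ∧ cotangent.Pi.ber.par j = 0 then -1 else 1) *
    (cotangent.Pi.ber.M)⁻¹ j i = _
  rw [hinv, if_neg, one_mul]
  · rintro ⟨h1, h2⟩
    rw [Subsingleton.elim i j, h2] at h1
    exact zero_ne_one h1

/-! ## Supersymmetric powers -/

namespace SuperPoly

variable {W : Opens ℂ}

/-- Since `f² = 0` and `a` is even, the binomial formula stops after two terms. At `n = 0` the
truncated `n - 1` is harmless because the coefficient carries the factor `n`. -/
theorem pow_lin {a b : SFun W} (ha : SFun.invol W a = a) (n : ℕ) :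
    (lin a b).pow n = ⟨Polynomial.monomial n (a ^ n), Polynomial.monomial (n - 1) (n * a ^ (n - 1) * b)⟩ := by
  induction n with
  | zero => simp [pow]
  | succ n ih =>
    rw [pow, ih, mul, lin]
    simp only [Polynomial.C_mul_X_eq_monomial, Polynomial.map_monomial, ha,
      Polynomial.monomial_mul_monomial, Polynomial.monomial_mul_C, Nat.add_sub_cancel]
    rw [← pow_succ]
    congr 1
    cases n with
    | zero => simp
    | succ n =>
      rw [Nat.add_sub_cancel, ← map_add]
      congr 1
      push_cast
      ring

end SuperPoly

/-- The rows expand `(ae + bf)^(m+1)` and `(ae + bf)^m (ce + df)`. The latter has an extra term `m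
a^(m-1) b σ(c) eᵐ f`, removed by `hbc`; in both applications triangularity makes `b` or `c` zero. -/
theorem LocFree.sym_M_apply (E : LocFree (Fin 2)) (m : ℕ) (ha : SFun.invol Cstar (E.M 1 1) = E.M 1 1)
    (hbc : E.M 1 0 * SFun.invol Cstar (E.M 0 1) = 0) (i j : SymIdx (m + 1)) :
    (E.sym (m + 1)).M i j = !![E.M 1 1 ^ (m + 1), (m + 1) * E.M 1 1 ^ m * E.M 1 0;
      E.M 1 1 ^ m * E.M 0 1, E.M 1 1 ^ m * E.M 0 0] i.1 j.1 := by
  obtain ⟨i, hi⟩ := i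
  obtain ⟨j, hj⟩ := j
  change (((SuperPoly.lin (E.M 1 1) (E.M 1 0)).pow (m + 1 - (i : ℕ))).mul
      ((SuperPoly.lin (E.M 0 1) (E.M 0 0)).pow (i : ℕ))).coeff (m + 1 - (j : ℕ)) j = _
  have h1 : (SuperPoly.lin (E.M 0 1) (E.M 0 0)).pow 1 =
      ⟨Polynomial.monomial 1 (E.M 0 1), Polynomial.C (E.M 0 0)⟩ := by
    simp [SuperPoly.pow, SuperPoly.mul, SuperPoly.lin, Polynomial.C_mul_X_eq_monomial]
  have hbc' : ∀ x : SFun Cstar, x * E.M 1 0 * SFun.invol Cstar (E.M 0 1) = 0 := fun x => by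
    rw [mul_assoc, hbc, mul_zero]
  rw [SuperPoly.pow_lin ha]
  fin_cases i <;> fin_cases j
  · simp [SuperPoly.pow, SuperPoly.mul, SuperPoly.coeff]
  · simp [SuperPoly.pow, SuperPoly.mul, SuperPoly.coeff]
  · simp [h1, SuperPoly.mul, SuperPoly.coeff, Polynomial.monomial_mul_monomial]
  · simp [h1, SuperPoly.mul, SuperPoly.coeff, Polynomial.monomial_mul_monomial, hbc']

/-! ## Decomposition into line bundles -/

theorem idFn_pow_eq (m : ℕ) : ((wUnit ^ (m : ℤ) : (Hol Cstar)ˣ) : Hol Cstar) = idFn ^ m := by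
  rw [zpow_natCast, Units.val_pow_eq_pow_val]
  rfl

theorem invFn_pow_eq (k : ℕ) :
    ((wUnit ^ (-(k : ℤ) - 1) : (Hol Cstar)ˣ) : Hol Cstar) = invFn ^ (k + 1) := by
  rw [show -(k : ℤ) - 1 = -((k + 1 : ℕ) : ℤ) by push_cast; ring, zpow_neg, zpow_natCast, ← inv_pow,
    Units.val_pow_eq_pow_val]
  rfl

/-- The coordinate function on the plane. -/
def Hol.coord : Hol ⊤ := ⟨fun z => z, fun z => z, differentiableOn_id, fun _ => rfl⟩

theorem Hol.ofEntire_coord : Hol.ofEntire Cstar Hol.coord = idFn := rfl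

theorem Hol.ofEntireInv_coord : Hol.ofEntireInv Hol.coord = invFn := rfl

namespace LocFree

open SFun SuperMod

section RankTwo

theorem nonempty_partIso_of_red {ι : Type} [Fintype ι] [DecidableEq ι] (E : LocFree ι) (e : ι ≃ Fin 2) (p : ZMod 2) (n : ℤ)
    (hM : ∀ i j, (E.M i j).HasParity (E.par i + E.par j)) {N : Matrix (Fin 2) (Fin 2) (Hol Cstar)}
    (hN : E.red p = N.submatrix e e) {P P' Q Q' : Matrix (Fin 2) (Fin 2) (Hol ⊤)}
    (hP : P * P' = 1) (hQ : Q * Q' = 1)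
    (key : N * Q.map (Hol.ofEntire Cstar) =
      ((wUnit ^ n : (Hol Cstar)ˣ) : Hol Cstar) • P.map Hol.ofEntireInv) :
    Nonempty (PartIso E.sheaf p ((lineBundle n).sum (lineBundle n)) 0) := by
  refine ⟨(E.partIsoCopies p n hM (P.submatrix e e) (P'.submatrix e e) (Q.submatrix e e)
    (Q'.submatrix e e) ?_ ?_ ?_).trans (copiesTwo _ 0 e)⟩
  · rw [Matrix.submatrix_mul_equiv, hP, Matrix.submatrix_one_equiv]
  · rw [Matrix.submatrix_mul_equiv, hQ, Matrix.submatrix_one_equiv]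
  · rw [hN, ← Matrix.submatrix_map, Matrix.submatrix_mul_equiv, key]
    rfl

variable {ι : Type} {E : LocFree ι} {e : ι ≃ Fin 2} {q : ZMod 2} {a b c d : Hol Cstar}

theorem hasParity_of_eq (hpar : ∀ i, E.par i = if e i = 0 then q else q + 1)
    (hM : ∀ i j, E.M i j = !![TrivSqZeroExt.inl a, TrivSqZeroExt.inr b;
      TrivSqZeroExt.inr c, TrivSqZeroExt.inl d] (e i) (e j)) (i j : ι) :
    (E.M i j).HasParity (E.par i + E.par j) := by
  have h2 : ∀ q : ZMod 2, q + q = 0 := by decide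
  have h3 : ∀ q : ZMod 2, q + (q + 1) = 1 := by decide
  have h4 : ∀ q : ZMod 2, q + 1 + q = 1 := by decide
  rw [hM, hpar, hpar]
  generalize e i = i'
  generalize e j = j'
  fin_cases i' <;> fin_cases j' <;> simp only [Fin.zero_eta, Fin.mk_one, if_true,
    if_neg (one_ne_zero : (1 : Fin 2) ≠ 0), h2, h3, h4]
  · exact hasParity_inl a
  · exact hasParity_inr b
  · exact hasParity_inr c
  · exact hasParity_inl d

/-- The first generator has an even coefficient and the second an odd one, which contributes `θ₀ =
w⁻¹θ₁`. The entry `c` disappears because `θ² = 0`. -/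
theorem red_of_add_eq_zero (hpar : ∀ i, E.par i = if e i = 0 then q else q + 1)
    (hM : ∀ i j, E.M i j = !![TrivSqZeroExt.inl a, TrivSqZeroExt.inr b;
      TrivSqZeroExt.inr c, TrivSqZeroExt.inl d] (e i) (e j)) {p : ZMod 2} (h : p + q = 0) :
    E.red p = (!![a, b; 0, invFn * d]).submatrix e e := by
  ext i j : 1
  have h1 : p + (q + 1) = 1 := by rw [← add_assoc, h, zero_add]
  change comp (p + E.par j) (frameCoeff (p + E.par i) * E.M i j) = !![a, b; 0, invFn * d] (e i) (e j)
  rw [hM, hpar, hpar]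
  generalize e i = i'
  generalize e j = j'
  fin_cases i' <;> fin_cases j' <;>
    simp [h, h1, comp_zero, comp_one, frameCoeff, emb_zero, emb_one]

/-- The roles of the two generators are exchanged, and now `θ² = 0` kills `b`. -/
theorem red_of_add_eq_one (hpar : ∀ i, E.par i = if e i = 0 then q else q + 1)
    (hM : ∀ i j, E.M i j = !![TrivSqZeroExt.inl a, TrivSqZeroExt.inr b;
      TrivSqZeroExt.inr c, TrivSqZeroExt.inl d] (e i) (e j)) {p : ZMod 2} (h : p + q = 1) :
    E.red p = (!![invFn * a, 0; c, d]).submatrix e e := by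
  ext i j : 1
  have h1 : p + (q + 1) = 0 := by rw [← add_assoc, h]; rfl
  change comp (p + E.par j) (frameCoeff (p + E.par i) * E.M i j) = !![invFn * a, 0; c, d] (e i) (e j)
  rw [hM, hpar, hpar]
  generalize e i = i'
  generalize e j = j'
  fin_cases i' <;> fin_cases j' <;>
    simp [h, h1, comp_zero, comp_one, frameCoeff, emb_zero, emb_one, mul_comm]

end RankTwo

/-- A sheaf of rank one whose transition function is `± wⁿ` in parity `p`. -/
theorem nonempty_partIso_rank_one (E : LocFree Unit) (p : ZMod 2) (n : ℤ) {a : Hol Cstar}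
    (hM : E.M = Matrix.of fun _ _ => TrivSqZeroExt.inl a) {ε : Hol ⊤} (hε : ε * ε = 1)
    (h : (if p + E.par () = 0 then a else invFn * a) * Hol.ofEntire Cstar ε =
      ((wUnit ^ n : (Hol Cstar)ˣ) : Hol Cstar)) :
    Nonempty (PartIso E.sheaf p (lineBundle n) 0) := by
  refine ⟨(E.partIsoCopies p n (fun i j => ?_) 1 1 (Matrix.of fun _ _ => ε)
    (Matrix.of fun _ _ => ε) (one_mul 1) ?_ ?_).trans (copiesUnit _ 0)⟩
  · have h2 : ∀ q : ZMod 2, q + q = 0 := by decide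
    rw [Subsingleton.elim i j, h2, hM]
    exact hasParity_inl a
  · ext i j : 1
    rw [Subsingleton.elim i j, Matrix.one_apply_eq, Matrix.mul_apply]
    simpa using hε
  · ext i j : 1
    rw [Matrix.map_one _ (map_zero _) (map_one _), Matrix.mul_apply, Subsingleton.elim i (),
      Subsingleton.elim j (), Matrix.smul_apply, Matrix.one_apply_eq, smul_eq_mul, mul_one, ← h]
    simp only [Finset.univ_unique, Finset.sum_singleton, Matrix.map_apply, Matrix.of_apply]
    congr 1
    change comp (p + E.par ()) (frameCoeff (p + E.par ()) * E.M () ()) = _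
    rw [hM]
    rcases zmod_two_cases (p + E.par ()) with h0 | h0 <;>
      simp [h0, frameCoeff, comp_zero, comp_one, emb_zero, emb_one, mul_comm]

end LocFree

section LargeHilbertSpace

open SuperMod

/-! ### The structure sheaf and the Berezinian sheaf -/

theorem structSheaf_hasCohomology_zero : structSheaf.sheaf.HasCohomology 0 1 0 := by
  have hM : structSheaf.M = Matrix.of fun _ _ => TrivSqZeroExt.inl 1 := by
    ext i j : 1
    rw [Subsingleton.elim i j]
    exact Matrix.one_apply_eq j
  obtain ⟨e⟩ := structSheaf.nonempty_partIso_rank_one 0 (0 : ℕ) hM (one_mul 1) (by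
    simp [structSheaf])
  exact (lineBundle_hasCohomology_of_nonneg 0).congr e

/-- The odd functions `bθ` form 𝒪(-1), which has no cohomology. -/
theorem structSheaf_hasCohomology_one : structSheaf.sheaf.HasCohomology 1 0 0 := by
  have hM : structSheaf.M = Matrix.of fun _ _ => TrivSqZeroExt.inl 1 := by
    ext i j : 1
    rw [Subsingleton.elim i j]
    exact Matrix.one_apply_eq j
  obtain ⟨e⟩ := structSheaf.nonempty_partIso_rank_one 1 (-(0 : ℕ) - 1) hM (one_mul 1) (by
    rw [invFn_pow_eq]
    simp [structSheaf])
  exact (lineBundle_hasCohomology_of_neg 0).congr e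

/-- Even coefficients glue by `-w⁻¹` and form 𝒪(-1); odd ones acquire another `w⁻¹` and form 𝒪(-2).
Leaving the parity of the generator free covers the Berezinian sheaf and its parity reversal
together. -/
theorem hasCohomology_of_ber {E : LocFree Unit} (hM : E.M = berP11.M) {p : ZMod 2} :
    (p + E.par () = 0 → E.sheaf.HasCohomology p 0 0) ∧
      (p + E.par () = 1 → E.sheaf.HasCohomology p 0 1) := by
  constructor
  · intro h
    obtain ⟨e⟩ := E.nonempty_partIso_rank_one p (-(0 : ℕ) - 1) (hM.trans berP11_M)
      (ε := -1) (by rw [neg_mul_neg, one_mul]) (by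
        rw [invFn_pow_eq]
        simp [h])
    exact (lineBundle_hasCohomology_of_neg 0).congr e
  · intro h
    obtain ⟨e⟩ := E.nonempty_partIso_rank_one p (-(1 : ℕ) - 1) (hM.trans berP11_M)
      (ε := -1) (by rw [neg_mul_neg, one_mul]) (by
        rw [invFn_pow_eq]
        simp [h, sq])
    exact (lineBundle_hasCohomology_of_neg 1).congr e

/-! ### Factorisation of the transition matrices of the symmetric powers -/

/-- The monomials of degree `m + 1` are indexed by `Fin 2`. -/
def symIdxEquiv (m : ℕ) : SymIdx (m + 1) ≃ Fin 2 :=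
  Equiv.subtypeUnivEquiv fun b => by omega

theorem cast_fin_two (b : Fin 2) : (((b : ℕ) : ZMod 2)) = if b = 0 then 0 else 0 + 1 := by
  fin_cases b <;> rfl

theorem superforms_M (m : ℕ) (i j : SymIdx (m + 1)) :
    (superforms (m + 1)).M i j = !![TrivSqZeroExt.inl (invFn ^ (m + 1)),
      TrivSqZeroExt.inr (-((m + 1) * invFn ^ (m + 2))); TrivSqZeroExt.inr 0,
      TrivSqZeroExt.inl (-invFn ^ (m + 2))] (symIdxEquiv m i) (symIdxEquiv m j) := by
  have hM : cotangent.Pi.M = _ := cotangent_M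
  rw [superforms, LocFree.sym_M_apply]
  · rw [hM]
    change _ = !![_, _; _, _] i.1 j.1
    generalize i.1 = i'
    generalize j.1 = j'
    fin_cases i' <;> fin_cases j' <;> simp <;> ext1 <;> simp <;> ring
  · rw [hM]
    ext1 <;> simp [SFun.invol, SFun.pull]
  · rw [hM]
    simp

theorem polyvectors_M (m : ℕ) (i j : SymIdx (m + 1)) :
    (polyvectors (m + 1)).M i j = !![TrivSqZeroExt.inl (idFn ^ (m + 1)), 0;
      TrivSqZeroExt.inr (-idFn ^ (m + 1)),
      TrivSqZeroExt.inl (-idFn ^ (m + 2))] (symIdxEquiv m i) (symIdxEquiv m j) := by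
  have hM : tangent.Pi.M = _ := tangent_M
  rw [polyvectors, LocFree.sym_M_apply]
  · rw [hM]
    change _ = !![_, _; _, _] i.1 j.1
    generalize i.1 = i'
    generalize j.1 = j'
    fin_cases i' <;> fin_cases j' <;> simp <;> ext1 <;> simp <;> ring
  · rw [hM]
    ext1 <;> simp [SFun.invol, SFun.pull]
  · rw [hM]
    simp

/-- The nonsplit case: an extension involving 𝒪(-k) and 𝒪(-k-2), with `k = m + 1`, whose
off-diagonal entry is `-k w^(-k-1)`. That `k` is invertible in ℂ is what makes it 𝒪(-k-1)². -/
theorem superforms_partIso_zero (m : ℕ) : Nonempty (PartIso (superforms (m + 1)).sheaf 0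
    ((lineBundle (-((m + 1 : ℕ) : ℤ) - 1)).sum (lineBundle (-((m + 1 : ℕ) : ℤ) - 1))) 0) := by
  have hpar : ∀ i, (superforms (m + 1)).par i = if symIdxEquiv m i = 0 then 0 else 0 + 1 :=
    fun i => cast_fin_two i.1
  have h := idFn_mul_invFn
  -- The scalar `1/(m+1)`, taken in every ℂ-algebra at once so that all pull-backs fix it.
  let κ : ∀ {R : Type} [CommRing R] [Algebra ℂ R], R := fun {R} _ _ => algebraMap ℂ R (m + 1 : ℂ)⁻¹
  have hκ : ∀ {R : Type} [CommRing R] [Algebra ℂ R], (κ : R) * (m + 1) = 1 := fun {R} _ _ => by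
    have : ((m : R) + 1) = algebraMap ℂ R (m + 1) := by simp
    rw [this, ← map_mul, inv_mul_cancel₀ (by exact_mod_cast m.succ_ne_zero), map_one]
  have hmap : ∀ {R S : Type} [CommRing R] [Algebra ℂ R] [CommRing S] [Algebra ℂ S] (f : R →ₐ[ℂ] S),
    f κ = κ := fun f => f.commutes _
  refine LocFree.nonempty_partIso_of_red _ (symIdxEquiv m) 0 _
    (LocFree.hasParity_of_eq hpar (superforms_M m))
    (LocFree.red_of_add_eq_zero hpar (superforms_M m) (zero_add 0))
    -- The matrix is `w^(-m-2)` times one with columns `c₁ = (w, 0)` and `c₂ = (-(m+1), -w⁻¹)`. The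
    -- columns of `Q` encode `-κ c₂ = (1, κ w⁻¹)` and `-(m+1) c₁ - w c₂ = (0, 1)`, whose entries are
    -- polynomial in `w⁻¹`.
    (P := !![1, 0; κ * Hol.coord, 1]) (P' := !![1, 0; -(κ * Hol.coord), 1])
    (Q := !![0, -(m + 1); -κ, -Hol.coord]) (Q' := !![Hol.coord, -(m + 1); -κ, 0]) ?_ ?_ ?_
  · ext i j : 1
    fin_cases i <;> fin_cases j <;> simp [Matrix.mul_apply, Fin.sum_univ_two]
  · ext i j : 1
    fin_cases i <;> fin_cases j <;> simp [Matrix.mul_apply, Fin.sum_univ_two]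
    · linear_combination hκ (R := Hol ⊤)
    · ring
    · linear_combination hκ (R := Hol ⊤)
  · rw [invFn_pow_eq]
    ext i j : 1
    fin_cases i <;> fin_cases j <;>
      simp [Matrix.mul_apply, Fin.sum_univ_two, hmap, Hol.ofEntire_coord, Hol.ofEntireInv_coord]
    · linear_combination invFn ^ (m + 2) * hκ (R := Hol Cstar)
    · linear_combination (m + 1) * invFn ^ (m + 1) * h
    · ring
    · linear_combination invFn ^ (m + 2) * h

/-- The entry `c` of `superforms_M` is zero, so this matrix is already diagonal and only a sign has
to be removed. -/
theorem superforms_partIso_one (m : ℕ) : Nonempty (PartIso (superforms (m + 1)).sheaf 1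
    ((lineBundle (-((m + 1 : ℕ) : ℤ) - 1)).sum (lineBundle (-((m + 1 : ℕ) : ℤ) - 1))) 0) := by
  have hpar : ∀ i, (superforms (m + 1)).par i = if symIdxEquiv m i = 0 then 0 else 0 + 1 :=
    fun i => cast_fin_two i.1
  refine LocFree.nonempty_partIso_of_red _ (symIdxEquiv m) 1 _
    (LocFree.hasParity_of_eq hpar (superforms_M m))
    (LocFree.red_of_add_eq_one hpar (superforms_M m) (add_zero 1))
    (P := 1) (P' := 1) (Q := !![1, 0; 0, -1]) (Q' := !![1, 0; 0, -1]) (one_mul 1) ?_ ?_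
  · ext i j : 1
    fin_cases i <;> fin_cases j <;> simp [Matrix.mul_apply, Fin.sum_univ_two]
  · rw [invFn_pow_eq]
    ext i j : 1
    fin_cases i <;> fin_cases j <;>
      simp [Matrix.mul_apply, Fin.sum_univ_two]
    ring

/-- The constant `ε = ±1` is the Koszul sign from the generator of the Berezinian sheaf, so both
twists are treated at once. For `p + q = 0` the matrix is diagonal; for `p + q = 1` it is nonsplit
with diagonal `-w^(m-1)`, `w^(m+1)`. -/
theorem partIso_of_ber_tensor {ι : Type} [Fintype ι] [DecidableEq ι] {E : LocFree ι} {e : ι ≃ Fin 2}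
    {q : ZMod 2} {m : ℕ} {ε : ∀ {W : Opens ℂ}, Hol W} (hpar : ∀ i, E.par i = if e i = 0 then q else q + 1)
    (hε : ∀ {W : Opens ℂ}, (ε : Hol W) * ε = 1)
    (hε0 : Hol.ofEntire Cstar ε = ε) (hε1 : Hol.ofEntireInv ε = ε)
    (hM : ∀ i j, E.M i j = !![TrivSqZeroExt.inl (-idFn ^ m), TrivSqZeroExt.inr 0;
      TrivSqZeroExt.inr (ε * idFn ^ m), TrivSqZeroExt.inl (idFn ^ (m + 1))] (e i) (e j)) (p : ZMod 2) :
    Nonempty (PartIso E.sheaf p ((lineBundle m).sum (lineBundle m)) 0) := by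
  have h := idFn_mul_invFn
  rcases zmod_two_cases (p + q) with hp | hp
  · refine LocFree.nonempty_partIso_of_red _ e p _
      (LocFree.hasParity_of_eq hpar hM) (LocFree.red_of_add_eq_zero hpar hM hp)
      (P := 1) (P' := 1) (Q := !![-1, 0; 0, 1]) (Q' := !![-1, 0; 0, 1]) (one_mul 1) ?_ ?_
    · ext i j : 1
      fin_cases i <;> fin_cases j <;> simp [Matrix.mul_apply, Fin.sum_univ_two]
    · rw [idFn_pow_eq]
      ext i j : 1
      fin_cases i <;> fin_cases j <;>
        simp [Matrix.mul_apply, Fin.sum_univ_two]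
      linear_combination idFn ^ m * h
  · refine LocFree.nonempty_partIso_of_red _ e p _
      (LocFree.hasParity_of_eq hpar hM) (LocFree.red_of_add_eq_one hpar hM hp)
      -- Up to `wᵐ` the columns are `c₁ = (-w⁻¹, ε)` and `c₂ = (0, w)`. The columns of `Q` encode
      -- `-w c₁ + ε c₂ = (1, 0)` and `ε c₁ = (-ε w⁻¹, 1)`.
      (P := !![1, -(ε * Hol.coord); 0, 1]) (P' := !![1, ε * Hol.coord; 0, 1])
      (Q := !![-Hol.coord, ε; ε, 0]) (Q' := !![0, ε; ε, Hol.coord]) ?_ ?_ ?_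
    · ext i j : 1
      fin_cases i <;> fin_cases j <;> simp [Matrix.mul_apply, Fin.sum_univ_two]
    · ext i j : 1
      fin_cases i <;> fin_cases j <;> simp [Matrix.mul_apply, Fin.sum_univ_two, hε]
      ring
    · rw [idFn_pow_eq]
      ext i j : 1
      fin_cases i <;> fin_cases j <;>
        simp [Matrix.mul_apply, Fin.sum_univ_two, hε0, hε1, Hol.ofEntire_coord, Hol.ofEntireInv_coord]
      · linear_combination idFn ^ m * h
      · ring
      · ring
      · linear_combination idFn ^ m * hε (W := Cstar)

/-- The monomials of degree `m + 1`, multiplied by a generator of a sheaf of rank one. -/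
def unitProdSymIdxEquiv (m : ℕ) : Unit × SymIdx (m + 1) ≃ Fin 2 :=
  (Equiv.punitProd _).trans (symIdxEquiv m)

theorem ber_tensor_partIso (m : ℕ) (p : ZMod 2) :
    Nonempty (PartIso (berP11.tensor (polyvectors (m + 1))).sheaf p
      ((lineBundle m).sum (lineBundle m)) 0) := by
  refine partIso_of_ber_tensor (e := unitProdSymIdxEquiv m) (q := 0) (ε := 1)
    (fun i => (zero_add _).trans (cast_fin_two i.2.1)) (one_mul 1) (map_one _) (map_one _)
    (fun i j => ?_) p
  have h := idFn_mul_invFn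
  change berP11.M i.1 j.1 * (polyvectors (m + 1)).M i.2 j.2 = !![_, _; _, _] i.2.1 j.2.1
  rw [berP11_M, polyvectors_M]
  change _ * !![_, _; _, _] i.2.1 j.2.1 = _
  generalize i.2.1 = i'
  generalize j.2.1 = j'
  fin_cases i' <;> fin_cases j' <;> simp <;> ext1 <;> simp
  · linear_combination idFn ^ m * h
  · linear_combination idFn ^ m * h
  · linear_combination idFn ^ (m + 1) * h

/-- The odd generator applies the parity involution to the second factor, which flips the sign of
its `θ` entry; hence `ε = -1`. -/
theorem ber_Pi_tensor_partIso (m : ℕ) (p : ZMod 2) :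
    Nonempty (PartIso (berP11.Pi.tensor (polyvectors (m + 1))).sheaf p
      ((lineBundle m).sum (lineBundle m)) 0) := by
  refine partIso_of_ber_tensor (e := unitProdSymIdxEquiv m) (q := 1) (ε := -1)
    (fun i => ?_) (neg_mul_neg 1 1 |>.trans (one_mul 1)) (by simp) (by simp)
    (fun i j => ?_) p
  · change 1 + (((i.2.1 : ℕ) : ZMod 2)) = if i.2.1 = 0 then 1 else 1 + 1
    rw [cast_fin_two]
    split_ifs <;> rfl
  have h := idFn_mul_invFn
  change berP11.M i.1 j.1 * SFun.invol Cstar ((polyvectors (m + 1)).M i.2 j.2) =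
    !![_, _; _, _] i.2.1 j.2.1
  rw [berP11_M, polyvectors_M]
  change _ * SFun.invol Cstar (!![_, _; _, _] i.2.1 j.2.1) = _
  generalize i.2.1 = i'
  generalize j.2.1 = j'
  fin_cases i' <;> fin_cases j' <;> simp <;> ext1 <;> simp [SFun.invol, SFun.pull]
  · linear_combination idFn ^ m * h
  · linear_combination idFn ^ m * h
  · linear_combination idFn ^ (m + 1) * h

/-! ## The Large Hilbert Space -/

/-- Line bundles sit in even parity, so in each parity exactly one of the two outer summands of the
target survives. -/
theorem superforms_iso (m : ℕ) : Nonempty (SuperMod.Iso (superforms (m + 1)).sheaf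
    (((lineBundle (-((m + 1 : ℕ) : ℤ) - 1)).sum (lineBundle (-((m + 1 : ℕ) : ℤ) - 1))).sum
      ((lineBundle (-((m + 1 : ℕ) : ℤ) - 1)).sum (lineBundle (-((m + 1 : ℕ) : ℤ) - 1))).Pi)) := by
  have hsub : ∀ n V, Subsingleton (((lineBundle n).sum (lineBundle n)).obj V 1) := fun n V =>
    have := lineBundle_obj_one_subsingleton n V
    inferInstanceAs (Subsingleton ((lineBundle n).obj V 1 × (lineBundle n).obj V 1))
  refine nonempty_iso_of_partIso fun p => ?_
  rcases zmod_two_cases p with rfl | rfl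
  · exact (superforms_partIso_zero m).map fun e =>
      e.trans (PartIso.sumOfSubsingletonRight _ _ fun V => hsub _ V)
  · exact (superforms_partIso_one m).map fun e => (e.trans (PartIso.ofPi (p := 1) (q := 0) _ rfl).symm).trans
      (PartIso.sumOfSubsingletonLeft _ _ fun V => hsub _ V)

theorem superforms_hasCohomology (m : ℕ) (p : ZMod 2) :
    (superforms (m + 1)).sheaf.HasCohomology p 0 (2 * (m + 1)) := by
  rw [two_mul]
  have h := (lineBundle_hasCohomology_of_neg (m + 1)).sum (lineBundle_hasCohomology_of_neg (m + 1))
  rcases zmod_two_cases p with rfl | rfl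
  · exact h.congr (superforms_partIso_zero m).some
  · exact h.congr (superforms_partIso_one m).some

theorem ber_tensor_hasCohomology (m : ℕ) (p : ZMod 2) :
    (berP11.tensor (polyvectors (m + 1))).sheaf.HasCohomology p (2 * (m + 1)) 0 := by
  rw [two_mul]
  exact ((lineBundle_hasCohomology_of_nonneg m).sum (lineBundle_hasCohomology_of_nonneg m)).congr
    (ber_tensor_partIso m p).some

theorem ber_Pi_tensor_hasCohomology (m : ℕ) (p : ZMod 2) :
    (berP11.Pi.tensor (polyvectors (m + 1))).sheaf.HasCohomology p (2 * (m + 1)) 0 := by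
  rw [two_mul]
  exact ((lineBundle_hasCohomology_of_nonneg m).sum (lineBundle_hasCohomology_of_nonneg m)).congr
    (ber_Pi_tensor_partIso m p).some

theorem berP11_hasCohomology_zero : berP11.sheaf.HasCohomology 0 0 0 :=
  (hasCohomology_of_ber rfl).1 rfl

theorem berP11_hasCohomology_one : berP11.sheaf.HasCohomology 1 0 1 :=
  (hasCohomology_of_ber rfl).2 rfl

theorem berP11_Pi_hasCohomology_zero : berP11.Pi.sheaf.HasCohomology 0 0 1 :=
  (hasCohomology_of_ber (E := berP11.Pi) rfl).2 rfl

theorem berP11_Pi_hasCohomology_one : berP11.Pi.sheaf.HasCohomology 1 0 0 :=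
  (hasCohomology_of_ber (E := berP11.Pi) rfl).1 rfl

theorem LHS_of_pos {k : ℤ} (hk : 0 < k) : LHS k = (superforms k.natAbs).sheaf := if_pos hk

theorem LHS_zero :
    LHS 0 = (structSheaf.sheaf.sum berP11.Pi.sheaf).sum berP11.sheaf := by
  rw [LHS, if_neg (lt_irrefl 0), if_pos rfl]

theorem LHS_of_neg {k : ℤ} (hk : k < 0) :
    LHS k = ((berP11.Pi.tensor (polyvectors k.natAbs)).sheaf).sum
      (berP11.tensor (polyvectors k.natAbs)).sheaf := by
  rw [LHS, if_neg hk.not_gt, if_neg hk.ne]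

end LargeHilbertSpace

/-! ### Assembly of the theorem -/

theorem mainTheorem5 :
    (∀ k : ℕ, 1 ≤ k →
      Nonempty (SuperMod.Iso (superforms k).sheaf
        (((lineBundle (-(k : ℤ) - 1)).sum (lineBundle (-(k : ℤ) - 1))).sum
          ((lineBundle (-(k : ℤ) - 1)).sum (lineBundle (-(k : ℤ) - 1))).Pi)) ∧
      IsSuperC (superforms k).sheaf.H0 0 0 ∧
      IsSuperC (superforms k).sheaf.H1 (2 * k) (2 * k) ∧
      IsSuperC (berP11.tensor (polyvectors k)).sheaf.H0 (2 * k) (2 * k) ∧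
      IsSuperC (berP11.tensor (polyvectors k)).sheaf.H1 0 0 ∧
      IsSuperC (berP11.Pi.tensor (polyvectors k)).sheaf.H0 (2 * k) (2 * k) ∧
      IsSuperC (berP11.Pi.tensor (polyvectors k)).sheaf.H1 0 0) ∧
    (IsSuperC structSheaf.sheaf.H0 1 0 ∧ IsSuperC structSheaf.sheaf.H1 0 0 ∧
      IsSuperC berP11.sheaf.H0 0 0 ∧ IsSuperC berP11.sheaf.H1 0 1 ∧
      IsSuperC berP11.Pi.sheaf.H0 0 0 ∧ IsSuperC berP11.Pi.sheaf.H1 1 0) ∧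
    (∀ k : ℤ, 0 < k →
      IsSuperC (LHS k).H0 0 0 ∧ IsSuperC (LHS k).H1 (2 * k.natAbs) (2 * k.natAbs)) ∧
    (IsSuperC (LHS 0).H0 1 0 ∧ IsSuperC (LHS 0).H1 1 1) ∧
    (∀ k : ℤ, k < 0 →
      IsSuperC (LHS k).H0 (2 * k.natAbs + 2 * k.natAbs) (2 * k.natAbs + 2 * k.natAbs) ∧
      IsSuperC (LHS k).H1 0 0) := by
  refine ⟨fun k hk => ?_, ⟨?_, ?_, ?_, ?_, ?_, ?_⟩, fun k hk => ?_, ?_, fun k hk => ?_⟩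
  -- Writing `k = m + 1` ensures that both monomials `eᵏ` and `e^(k-1) f` exist.
  · obtain ⟨m, rfl⟩ := Nat.exists_eq_add_of_le' hk
    have h1 := (superforms_hasCohomology m 0).isSuperC (superforms_hasCohomology m 1)
    have h2 := (ber_tensor_hasCohomology m 0).isSuperC (ber_tensor_hasCohomology m 1)
    have h3 := (ber_Pi_tensor_hasCohomology m 0).isSuperC (ber_Pi_tensor_hasCohomology m 1)
    exact ⟨superforms_iso m, h1.1, h1.2, h2.1, h2.2, h3.1, h3.2⟩
  · exact (structSheaf_hasCohomology_zero.isSuperC structSheaf_hasCohomology_one).1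
  · exact (structSheaf_hasCohomology_zero.isSuperC structSheaf_hasCohomology_one).2
  · exact (berP11_hasCohomology_zero.isSuperC berP11_hasCohomology_one).1
  · exact (berP11_hasCohomology_zero.isSuperC berP11_hasCohomology_one).2
  · exact (berP11_Pi_hasCohomology_zero.isSuperC berP11_Pi_hasCohomology_one).1
  · exact (berP11_Pi_hasCohomology_zero.isSuperC berP11_Pi_hasCohomology_one).2
  · rw [LHS_of_pos hk]
    obtain ⟨m, hm⟩ := Nat.exists_eq_add_of_le' (Int.natAbs_pos.2 hk.ne')
    rw [hm]
    exact (superforms_hasCohomology m 0).isSuperC (superforms_hasCohomology m 1)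
  · rw [LHS_zero]
    have h0 := (structSheaf_hasCohomology_zero.sum berP11_Pi_hasCohomology_zero).sum
      berP11_hasCohomology_zero
    have h1 := (structSheaf_hasCohomology_one.sum berP11_Pi_hasCohomology_one).sum
      berP11_hasCohomology_one
    -- The dimensions appear as sums such as `(0 + 1) + 0`, which evaluate to the stated ones.
    exact h0.isSuperC h1
  · rw [LHS_of_neg hk]
    have hn : 1 ≤ k.natAbs := Int.natAbs_pos.2 hk.ne
    generalize k.natAbs = n at hn
    obtain ⟨m, rfl⟩ := Nat.exists_eq_add_of_le' hn
    have h : ∀ p, SuperMod.HasCohomology _ p (2 * (m + 1) + 2 * (m + 1)) 0 := fun p =>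
      (ber_Pi_tensor_hasCohomology m p).sum (ber_tensor_hasCohomology m p)
    exact (h 0).isSuperC (h 1)
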